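/- Let $p$ be a prime and $[x,y]=x^{-1}y^{-1}xy$. A group is minimal non-abelian if it is non-abelian and all its proper subgroups are abelian; an $\mathcal A_1$-subgroup of a finite $p$-group $G$ is a minimal non-abelian subgroup of $G$ ($G$ itself allowed), and $p^{I_{\max}}$ denotes the maximal index of the $\mathcal A_1$-subgroups of $G$. Let $n,m\ge 1$ be integers, and let $\nu$ be $1$ or a quadratic non-residue modulo $p$ (so $\nu=1$ if $p=2$). Consider the following groups. (F) ($p=3$) the $3$-groups of maximal class of order $3^4$. For $m\ge1$, with $m>1$ if $p\le 3$: (G1) $\langle a,b,c\mid a^{p^{m+1}}=b^{p^m}=c^p=1,\ [a,b]=c,\ [c,a]=1,\ [c,b]=a^{\nu p^m}\rangle$; (G2) $\langle a,b,c,d\mid a^{p^m}=b^{p^m}=c^p=d^p=1,\ [a,b]=c,\ [c,a]=d,\ [c,b]=[d,a]=[d,b]=1\rangle$; (G3) $\langle a,b,c\mid a^{p^{m+1}}=b^{p^m}=c^p=1,\ [a,b]=c,\ [c,a]=a^{p^m},\ [c,b]=1\rangle$. For $p=2$: (H1) $\langle a,b,c,d\mid a^4=b^2=c^2=d^2=1,\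 [a,b]=c,\ [c,a]=d,\ [c,b]=[d,a]=[d,b]=1\rangle$; (H2) $\langle a,b,c\mid a^8=b^2=c^2=1,\ [a,b]=c,\ [c,a]=a^4,\ [c,b]=1\rangle$; (H3) $\langle a,b,c\mid a^8=c^2=1,\ b^2=a^4,\ [a,b]=c,\ [c,a]=b^2,\ [c,b]=1\rangle$. For $p=2$ and $n\ge 3$: (I1) $\langle a,b,c,d\mid a^{2^n}=b^2=c^2=d^2=1,\ [a,b]=c,\ [c,a]=d,\ [c,b]=[d,a]=[d,b]=1\rangle$; (I2) $\langle a,b,c\mid a^{2^{n+1}}=b^2=c^2=1,\ [a,b]=c,\ [c,a]=a^{2^n},\ [c,b]=1\rangle$; (I3) $\langle a,b,c\mid a^{2^n}=b^4=c^2=1,\ [a,b]=c,\ [c,a]=b^2,\ [c,b]=1\rangle$. For $n>m\ge 1$, with $m>1$ if $p=2$: (J1) $\langle a,b,c\mid a^{p^{n+1}}=b^{p^m}=c^p=1,\ [a,b]=c,\ [c,a]=1,\ [c,b]=a^{\nu p^n}\rangle$; (J2) $\langle a,b,c\mid a^{p^{n+1}}=b^{p^m}=c^p=1,\ [a,b]=c,\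 [c,a]=a^{p^n},\ [c,b]=1\rangle$; (J3) $\langle a,b,c\mid a^{p^n}=b^{p^{m+1}}=c^p=1,\ [a,b]=c,\ [c,a]=1,\ [c,b]=b^{p^m}\rangle$; (J4) $\langle a,b,c\mid a^{p^n}=b^{p^{m+1}}=c^p=1,\ [a,b]=c,\ [c,a]=b^{\nu p^m},\ [c,b]=1\rangle$; (J5) $\langle a,b,c,d\mid a^{p^n}=b^{p^m}=c^p=d^p=1,\ [a,b]=c,\ [c,a]=1,\ [c,b]=d,\ [d,a]=[d,b]=1\rangle$; (J6) $\langle a,b,c,d\mid a^{p^n}=b^{p^m}=c^p=d^p=1,\ [a,b]=c,\ [c,a]=d,\ [c,b]=1,\ [d,a]=[d,b]=1\rangle$. Let $G$ be isomorphic to one of these groups. Then: (1) $I_{\max}=1$ for type (F); (2) $I_{\max}=2$ for types (H1)–(H3), (I1)–(I3); (3) $I_{\max}=m$ for types (G1)–(G3), (J2), (J4), (J6); (4) $I_{\max}=n$ for types (J1), (J3), (J5). -/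

import Mathlib

/-- The commutator `[x, y] = x⁻¹ y⁻¹ x y` (the convention used in the presentations below). -/
def commR {G : Type*} [Group G] (x y : G) : G := x⁻¹ * y⁻¹ * x * y

/-- A group is minimal non-abelian if it is not abelian and all its proper subgroups are abelian.
The minimal non-abelian finite `p`-groups are the `𝒜₁`-groups. -/
def IsMinimalNonabelian (G : Type*) [Group G] : Prop :=
  (∃ x y : G, x * y ≠ y * x) ∧
    ∀ H : Subgroup G, H ≠ ⊤ → ∀ x ∈ H, ∀ y ∈ H, x * y = y * x

/-- `I_max = k` for the group `G`: the maximal index of the `𝒜₁`-subgroups of `G` exists and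
equals `p ^ k`. -/
def IsIMax (p : ℕ) (G : Type*) [Group G] (k : ℕ) : Prop :=
  IsGreatest {i : ℕ | ∃ H : Subgroup G, IsMinimalNonabelian H ∧ H.index = i} (p ^ k)

/-- `ν = 1` or `ν` is a quadratic non-residue modulo `p` (none exists for `p = 2`). -/
def IsOneOrNonresidue (p : ℕ) (ν : ℤ) : Prop := ν = 1 ∨ ¬ IsSquare (ν : ZMod p)

/-! In the presentations below the generators `a, b, c` (and `d`) are `0, 1, 2` (and `3`), and a
relation `u = v` is written as the relator `u * v⁻¹`. -/

/-- `⟨a, b, c ∣ a^(p^(n+1)) = b^(p^m) = c^p = 1, [a,b] = c, [c,a] = 1, [c,b] = a^(ν p^n)⟩` -/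
def relsJ1 (p n m : ℕ) (ν : ℤ) : Set (FreeGroup (Fin 3)) :=
  let a := FreeGroup.of 0
  let b := FreeGroup.of 1
  let c := FreeGroup.of 2
  {a ^ p ^ (n + 1), b ^ p ^ m, c ^ p,
    commR a b * c⁻¹, commR c a, commR c b * (a ^ (ν * (p : ℤ) ^ n))⁻¹}

/-- `⟨a, b, c ∣ a^(p^(n+1)) = b^(p^m) = c^p = 1, [a,b] = c, [c,a] = a^(p^n), [c,b] = 1⟩` -/
def relsJ2 (p n m : ℕ) : Set (FreeGroup (Fin 3)) :=
  let a := FreeGroup.of 0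
  let b := FreeGroup.of 1
  let c := FreeGroup.of 2
  {a ^ p ^ (n + 1), b ^ p ^ m, c ^ p,
    commR a b * c⁻¹, commR c a * (a ^ p ^ n)⁻¹, commR c b}

/-- `⟨a, b, c ∣ a^(p^n) = b^(p^(m+1)) = c^p = 1, [a,b] = c, [c,a] = 1, [c,b] = b^(p^m)⟩` -/
def relsJ3 (p n m : ℕ) : Set (FreeGroup (Fin 3)) :=
  let a := FreeGroup.of 0
  let b := FreeGroup.of 1
  let c := FreeGroup.of 2
  {a ^ p ^ n, b ^ p ^ (m + 1), c ^ p,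
    commR a b * c⁻¹, commR c a, commR c b * (b ^ p ^ m)⁻¹}

/-- `⟨a, b, c ∣ a^(p^n) = b^(p^(m+1)) = c^p = 1, [a,b] = c, [c,a] = b^(ν p^m), [c,b] = 1⟩` -/
def relsJ4 (p n m : ℕ) (ν : ℤ) : Set (FreeGroup (Fin 3)) :=
  let a := FreeGroup.of 0
  let b := FreeGroup.of 1
  let c := FreeGroup.of 2
  {a ^ p ^ n, b ^ p ^ (m + 1), c ^ p,
    commR a b * c⁻¹, commR c a * (b ^ (ν * (p : ℤ) ^ m))⁻¹, commR c b}

/-- `⟨a, b, c, d ∣ a^(p^n) = b^(p^m) = c^p = d^p = 1, [a,b] = c, [c,a] = 1, [c,b] = d,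
[d,a] = [d,b] = 1⟩` -/
def relsJ5 (p n m : ℕ) : Set (FreeGroup (Fin 4)) :=
  let a := FreeGroup.of 0
  let b := FreeGroup.of 1
  let c := FreeGroup.of 2
  let d := FreeGroup.of 3
  {a ^ p ^ n, b ^ p ^ m, c ^ p, d ^ p,
    commR a b * c⁻¹, commR c a, commR c b * d⁻¹, commR d a, commR d b}

/-- `⟨a, b, c, d ∣ a^(p^n) = b^(p^m) = c^p = d^p = 1, [a,b] = c, [c,a] = d, [c,b] = 1,
[d,a] = [d,b] = 1⟩` -/
def relsJ6 (p n m : ℕ) : Set (FreeGroup (Fin 4)) :=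
  let a := FreeGroup.of 0
  let b := FreeGroup.of 1
  let c := FreeGroup.of 2
  let d := FreeGroup.of 3
  {a ^ p ^ n, b ^ p ^ m, c ^ p, d ^ p,
    commR a b * c⁻¹, commR c a * d⁻¹, commR c b, commR d a, commR d b}

/-- `⟨a, b, c ∣ a^8 = c^2 = 1, b^2 = a^4, [a,b] = c, [c,a] = b^2, [c,b] = 1⟩` -/
def relsH3 : Set (FreeGroup (Fin 3)) :=
  let a := FreeGroup.of 0
  let b := FreeGroup.of 1
  let c := FreeGroup.of 2
  {a ^ 8, c ^ 2, b ^ 2 * (a ^ 4)⁻¹,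
    commR a b * c⁻¹, commR c a * (b ^ 2)⁻¹, commR c b}

/-- Type (F): the `3`-groups of maximal class of order `3 ^ 4`, i.e. of nilpotency class `3`. -/
def IsTypeF (p : ℕ) (G : Type*) [Group G] : Prop :=
  p = 3 ∧ Nat.card G = 3 ^ 4 ∧ ∃ _ : Group.IsNilpotent G, Group.nilpotencyClass G = 3

/-- Type (G1): `⟨a, b, c ∣ a^(p^(m+1)) = b^(p^m) = c^p = 1, [a,b] = c, [c,a] = 1,
[c,b] = a^(ν p^m)⟩`, where `m > 1` for `p ≤ 3`. -/
def IsTypeG1 (p n m : ℕ) (G : Type*) [Group G] : Prop :=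
  n = m ∧ 1 ≤ m ∧ (p ≤ 3 → 1 < m) ∧
    ∃ ν : ℤ, IsOneOrNonresidue p ν ∧ Nonempty (G ≃* PresentedGroup (relsJ1 p m m ν))

/-- Type (G2): `⟨a, b, c, d ∣ a^(p^m) = b^(p^m) = c^p = d^p = 1, [a,b] = c, [c,a] = d,
[c,b] = 1, [d,a] = [d,b] = 1⟩`, where `m > 1` for `p ≤ 3`. -/
def IsTypeG2 (p n m : ℕ) (G : Type*) [Group G] : Prop :=
  n = m ∧ 1 ≤ m ∧ (p ≤ 3 → 1 < m) ∧ Nonempty (G ≃* PresentedGroup (relsJ6 p m m))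

/-- Type (G3): `⟨a, b, c ∣ a^(p^(m+1)) = b^(p^m) = c^p = 1, [a,b] = c, [c,a] = a^(p^m),
[c,b] = 1⟩`, where `m > 1` for `p ≤ 3`. -/
def IsTypeG3 (p n m : ℕ) (G : Type*) [Group G] : Prop :=
  n = m ∧ 1 ≤ m ∧ (p ≤ 3 → 1 < m) ∧ Nonempty (G ≃* PresentedGroup (relsJ2 p m m))

/-- Type (H1): `⟨a, b, c, d ∣ a^4 = b^2 = c^2 = d^2 = 1, [a,b] = c, [c,a] = d,
[c,b] = [d,a] = [d,b] = 1⟩`. -/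
def IsTypeH1 (p n m : ℕ) (G : Type*) [Group G] : Prop :=
  p = 2 ∧ n = 2 ∧ m = 1 ∧ Nonempty (G ≃* PresentedGroup (relsJ6 2 2 1))

/-- Type (H2): `⟨a, b, c ∣ a^8 = b^2 = c^2 = 1, [a,b] = c, [c,a] = a^4, [c,b] = 1⟩`. -/
def IsTypeH2 (p n m : ℕ) (G : Type*) [Group G] : Prop :=
  p = 2 ∧ n = 2 ∧ m = 1 ∧ Nonempty (G ≃* PresentedGroup (relsJ2 2 2 1))

/-- Type (H3): `⟨a, b, c ∣ a^8 = c^2 = 1, b^2 = a^4, [a,b] = c, [c,a] = b^2, [c,b] = 1⟩`. -/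
def IsTypeH3 (p n m : ℕ) (G : Type*) [Group G] : Prop :=
  p = 2 ∧ n = 2 ∧ m = 1 ∧ Nonempty (G ≃* PresentedGroup relsH3)

/-- Type (I1): `⟨a, b, c, d ∣ a^(2^n) = b^2 = c^2 = d^2 = 1, [a,b] = c, [c,a] = d,
[c,b] = [d,a] = [d,b] = 1⟩`, where `n ≥ 3`. -/
def IsTypeI1 (p n m : ℕ) (G : Type*) [Group G] : Prop :=
  p = 2 ∧ 3 ≤ n ∧ m = 1 ∧ Nonempty (G ≃* PresentedGroup (relsJ6 2 n 1))

/-- Type (I2): `⟨a, b, c ∣ a^(2^(n+1)) = b^2 = c^2 = 1, [a,b] = c, [c,a] = a^(2^n),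
[c,b] = 1⟩`, where `n ≥ 3`. -/
def IsTypeI2 (p n m : ℕ) (G : Type*) [Group G] : Prop :=
  p = 2 ∧ 3 ≤ n ∧ m = 1 ∧ Nonempty (G ≃* PresentedGroup (relsJ2 2 n 1))

/-- Type (I3): `⟨a, b, c ∣ a^(2^n) = b^4 = c^2 = 1, [a,b] = c, [c,a] = b^2, [c,b] = 1⟩`,
where `n ≥ 3`. -/
def IsTypeI3 (p n m : ℕ) (G : Type*) [Group G] : Prop :=
  p = 2 ∧ 3 ≤ n ∧ m = 1 ∧ Nonempty (G ≃* PresentedGroup (relsJ4 2 n 1 1))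

/-- The conditions on `p, n, m` common to all types (J): `m ≥ 1`, `n > m`, and `m > 1` for
`p = 2`. -/
def ParamsJ (p n m : ℕ) : Prop := 1 ≤ m ∧ m < n ∧ (p = 2 → 1 < m)

/-- Type (J1). -/
def IsTypeJ1 (p n m : ℕ) (G : Type*) [Group G] : Prop :=
  ParamsJ p n m ∧
    ∃ ν : ℤ, IsOneOrNonresidue p ν ∧ Nonempty (G ≃* PresentedGroup (relsJ1 p n m ν))

/-- Type (J2). -/
def IsTypeJ2 (p n m : ℕ) (G : Type*) [Group G] : Prop :=
  ParamsJ p n m ∧ Nonempty (G ≃* PresentedGroup (relsJ2 p n m))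

/-- Type (J3). -/
def IsTypeJ3 (p n m : ℕ) (G : Type*) [Group G] : Prop :=
  ParamsJ p n m ∧ Nonempty (G ≃* PresentedGroup (relsJ3 p n m))

/-- Type (J4). -/
def IsTypeJ4 (p n m : ℕ) (G : Type*) [Group G] : Prop :=
  ParamsJ p n m ∧
    ∃ ν : ℤ, IsOneOrNonresidue p ν ∧ Nonempty (G ≃* PresentedGroup (relsJ4 p n m ν))

/-- Type (J5). -/
def IsTypeJ5 (p n m : ℕ) (G : Type*) [Group G] : Prop :=
  ParamsJ p n m ∧ Nonempty (G ≃* PresentedGroup (relsJ5 p n m))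

/-- Type (J6). -/
def IsTypeJ6 (p n m : ℕ) (G : Type*) [Group G] : Prop :=
  ParamsJ p n m ∧ Nonempty (G ≃* PresentedGroup (relsJ6 p n m))

/-! Apart from type (F), all the groups have one shape, recorded by `IsFrame`. Two elements `x, y`
generate `G`, with `w = [x, y]`, `z = [w, x]` central and `[w, y] = 1`. The derived subgroup is `⟨w,
z⟩`, with `w ^ p = z ^ p = 1`, and the abelianization is `ℤ/p^s × ℤ/p^t`. In types (J1), (J3), (J5)
and (G1) the generator not commuting with `c` is `b`, so `x = b`, `y = a`; otherwise `x = a`, `y =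
b`. The claim becomes: the maximal index is `p ^ t`, except that it is `4` when `p = 2` and `t = 1`.

It suffices to bound the index of non-abelian subgroups `H`, since one of largest index is minimal
non-abelian (`IsIMax.of_nonabelian`). The order of `G` is at most `p ^ (s + t + 2)`. If `H` does not
centralize `⟨w, z⟩`, then `H` maps onto `ℤ/p^s`. It also contains `z`, and the kernel of that map on
`H` has order at least `p ^ 2`, for otherwise `H` would be generated by `z` and one more element and
be abelian; so the index is at most `p ^ t` (`index_le_of_not_dvd`). If `H` centralizes `⟨w, z⟩`, it
lies in `⟨x ^ p, y, w, z⟩`, which is abelian for odd `p`. For `p = 2` this subgroup has `[x ^ 2, y]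
= z`, and a determinant argument gives index at most `4` (`index_le_four`). The bounds are attained
by `⟨x, w⟩` and `⟨x ^ 2, y⟩`.

That a presented group does not collapse (`z ≠ 1`, full abelianization) is shown by mapping it onto
an explicit quotient of a semidirect product (`exists_frame`, `IsFrame.hasFrame`). Type (F) is a
separate short argument with abelian maximal subgroups. -/

/-- Elements `x, y, w, z` with `[x, y] = w`, `[w, x] = z`, `[w, y] = 1`, `z` commuting with `x` and
`y`, `w ^ p = z ^ p = 1`, `x ^ (p ^ s) = z ^ α` and `y ^ (p ^ t) = z ^ β`. -/
structure IsFrame (p s t : ℕ) (α β : ℤ) {G : Type*} [Group G] (x y w z : G) : Prop where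
  xy : x * y = y * x * w
  wx : w * x = x * w * z
  wy : w * y = y * w
  zx : z * x = x * z
  zy : z * y = y * z
  wp : w ^ p = 1
  zp : z ^ p = 1
  xs : x ^ p ^ s = z ^ α
  yt : y ^ p ^ t = z ^ β

/-! ### Divisibility of binomial coefficients, and closures of commuting pairs. -/

lemma dvd_choose_two_of_odd {p i : ℕ} (hp : Odd p) (hi : p ∣ i) : p ∣ i.choose 2 := by
  have hc : Nat.Coprime p 2 := by simpa using hp
  refine hc.dvd_of_dvd_mul_left ?_
  rw [Nat.choose_two_right, Nat.mul_div_cancel' (Nat.even_mul_pred_self i).two_dvd]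
  exact hi.mul_right _

/-- Since `[x ^ i, y] = w ^ i * z ^ i.choose 2`, this divisibility is what makes `x ^ p ^ s`
central. It fails for `p ^ s = 2`, whence the condition at `p = 2`. -/
lemma dvd_pow_choose_two {p s : ℕ} (hp : p.Prime) (hs : 1 ≤ s) (hs2 : p = 2 → 2 ≤ s) :
    p ∣ (p ^ s).choose 2 := by
  rcases hp.eq_two_or_odd' with rfl | h2
  · obtain ⟨r, rfl⟩ : ∃ r, s = r + 2 := ⟨s - 2, by have := hs2 rfl; omega⟩
    rw [Nat.choose_two_right,
      show 2 ^ (r + 2) * (2 ^ (r + 2) - 1) = 2 * (2 * (2 ^ r * (2 ^ (r + 2) - 1))) by ring,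
      Nat.mul_div_cancel_left _ two_pos]
    exact dvd_mul_right _ _
  · exact dvd_choose_two_of_odd h2 (dvd_pow_self p (by omega))

lemma exists_zpow_mul_zpow_of_mem_closure_pair {G : Type*} [Group G] {a b : G} (h : Commute a b)
    {u : G} (hu : u ∈ Subgroup.closure {a, b}) : ∃ i j : ℤ, u = a ^ i * b ^ j := by
  induction hu using Subgroup.closure_induction with
  | mem u hu =>
    rcases hu with rfl | rfl
    exacts [⟨1, 0, by simp⟩, ⟨0, 1, by simp⟩]
  | one => exact ⟨0, 0, by simp⟩
  | mul u v _ _ hu hv =>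
    obtain ⟨i, j, rfl⟩ := hu
    obtain ⟨i', j', rfl⟩ := hv
    refine ⟨i + i', j + j', ?_⟩
    rw [zpow_add, zpow_add, mul_assoc, ← mul_assoc (b ^ j), ((h.zpow_zpow i' j).eq).symm, mul_assoc,
      mul_assoc]
  | inv u _ hu =>
    obtain ⟨i, j, rfl⟩ := hu
    refine ⟨-i, -j, ?_⟩
    rw [mul_inv_rev, ← zpow_neg, ← zpow_neg, (h.zpow_zpow (-i) (-j)).eq]

/-! ### An explicit group realizing every frame. -/

namespace FrameModel

/-- The automorphism of `ℤ × ℤ/p × ℤ/p` by which the first generator of the model acts. -/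
def shear (p : ℕ) : (ℤ × ZMod p × ZMod p) ≃+ (ℤ × ZMod p × ZMod p) where
  -- The coordinates are the exponents of `y, w, z`, and the map is conjugation by `x⁻¹`: `y ↦ y *
  -- w⁻¹`, `w ↦ w * z`, `z ↦ z`.
  toFun v := (v.1, v.2.1 - v.1, v.2.2 + v.2.1)
  invFun v := (v.1, v.2.1 + v.1, v.2.2 - (v.2.1 + v.1))
  left_inv v := by ext <;> simp
  right_inv v := by ext <;> simp
  map_add' u v := by ext <;> simp <;> ring

/-- The semidirect product of `ℤ × ℤ/p × ℤ/p` by `ℤ` acting through `shear`. -/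
abbrev Cover (p : ℕ) : Type :=
  SemidirectProduct (Multiplicative (ℤ × ZMod p × ZMod p)) (Multiplicative ℤ)
    (zpowersHom (MulAut (Multiplicative (ℤ × ZMod p × ZMod p)))
      (AddEquiv.toMultiplicative (shear p)))

variable {p : ℕ}

/-- The inclusion of the abelian normal subgroup. -/
def inN (v : ℤ × ZMod p × ZMod p) : Cover p := SemidirectProduct.inl (Multiplicative.ofAdd v)

/-- The inverse of the first generator. -/
def genT (p : ℕ) : Cover p := SemidirectProduct.inr (Multiplicative.ofAdd 1)

lemma inN_mul (u v : ℤ × ZMod p × ZMod p) : inN u * inN v = inN (u + v) := by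
  simp [inN, ofAdd_add]

lemma inN_zero : inN (0 : ℤ × ZMod p × ZMod p) = 1 := by
  simp [inN]

lemma inN_zpow (u : ℤ × ZMod p × ZMod p) (k : ℤ) : inN u ^ k = inN (k • u) := by
  rw [inN, inN, ofAdd_zsmul, map_zpow]

lemma inN_pow (u : ℤ × ZMod p × ZMod p) (k : ℕ) : inN u ^ k = inN (k • u) := by
  rw [inN, inN, ofAdd_nsmul, map_pow]

lemma inN_inj {u v : ℤ × ZMod p × ZMod p} : inN u = inN v ↔ u = v := by
  simp [inN, SemidirectProduct.inl_injective.eq_iff]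

lemma genT_conj (v : ℤ × ZMod p × ZMod p) : genT p * inN v = inN (shear p v) * genT p := by
  have h : inN (shear p v) = genT p * inN v * (genT p)⁻¹ := by
    have := SemidirectProduct.inl_aut (φ := zpowersHom
      (MulAut (Multiplicative (ℤ × ZMod p × ZMod p))) (AddEquiv.toMultiplicative (shear p)))
      (Multiplicative.ofAdd (1 : ℤ)) (Multiplicative.ofAdd v)
    simpa [inN, genT] using this
  rw [h, inv_mul_cancel_right]

lemma shear_iterate (q : ℕ) (v : ℤ × ZMod p × ZMod p) :
    (shear p)^[q] v = (v.1, v.2.1 - q * v.1, v.2.2 + q * v.2.1 - (q.choose 2 : ℕ) * v.1) := by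
  induction q with
  | zero => simp
  | succ q ih =>
    rw [Function.iterate_succ_apply', ih]
    ext
    · simp [shear]
    · simp [shear]; ring
    · simp [shear, Nat.choose_succ_succ' q 1]; ring

lemma genT_pow_conj (q : ℕ) (v : ℤ × ZMod p × ZMod p) :
    genT p ^ q * inN v = inN ((shear p)^[q] v) * genT p ^ q := by
  induction q with
  | zero => simp
  | succ q ih =>
    rw [Function.iterate_succ_apply', pow_succ', mul_assoc, ih, ← mul_assoc, genT_conj, mul_assoc]

lemma eq_inN_mul_genT (g : Cover p) : ∃ v k, g = inN v * genT p ^ (k : ℤ) := by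
  refine ⟨g.left.toAdd, g.right.toAdd, ?_⟩
  rw [genT, ← map_zpow, inN, ← ofAdd_zsmul]
  simp

lemma shear_zpow_fst (k : ℤ) (v : Multiplicative (ℤ × ZMod p × ZMod p)) :
    (Multiplicative.toAdd (((AddEquiv.toMultiplicative (shear p) :
      MulAut (Multiplicative (ℤ × ZMod p × ZMod p))) ^ k) v)).1 = v.toAdd.1 := by
  induction k using Int.induction_on generalizing v with
  | zero => simp
  | succ i ih => rw [zpow_add_one, MulAut.mul_apply, ih]; rfl
  | pred i ih => rw [zpow_sub_one, MulAut.mul_apply, ih]; rfl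

/-- The homomorphism of the cover to `ℤ × ℤ` given by the exponents of the two generators. -/
def expHom (p : ℕ) : Cover p →* Multiplicative (ℤ × ℤ) where
  toFun g := Multiplicative.ofAdd (-g.right.toAdd, g.left.toAdd.1)
  map_one' := rfl
  map_mul' g h := by
    rw [← ofAdd_add]
    congr 1
    ext
    · simp; ring
    · simp [shear_zpow_fst]

lemma expHom_inN (v : ℤ × ZMod p × ZMod p) : expHom p (inN v) = Multiplicative.ofAdd (0, v.1) := rfl

lemma expHom_genT : expHom p (genT p) = Multiplicative.ofAdd (-1, 0) := rfl

lemma genT_pow_mem_center {q : ℕ} (hq : p ∣ q) (hq2 : p ∣ q.choose 2) :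
    genT p ^ q ∈ Subgroup.center (Cover p) := by
  rw [Subgroup.mem_center_iff]
  intro g
  obtain ⟨v, k, rfl⟩ := eq_inN_mul_genT g
  have h : genT p ^ q * inN v = inN v * genT p ^ q := by
    rw [genT_pow_conj, shear_iterate, (ZMod.natCast_eq_zero_iff _ _).2 hq,
      (ZMod.natCast_eq_zero_iff _ _).2 hq2]
    simp
  rw [← mul_assoc, h, mul_assoc, mul_assoc, ← zpow_natCast, (Commute.refl (genT p)).zpow_zpow]

lemma inN_mem_center {v : ℤ × ZMod p × ZMod p} (hv : shear p v = v) :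
    inN v ∈ Subgroup.center (Cover p) := by
  rw [Subgroup.mem_center_iff]
  intro g
  obtain ⟨u, k, rfl⟩ := eq_inN_mul_genT g
  have h : Commute (genT p) (inN v) := by
    rw [Commute, SemiconjBy, genT_conj, hv]
  rw [mul_assoc, (h.zpow_left k).eq, ← mul_assoc, ← mul_assoc, inN_mul, inN_mul, add_comm]

end FrameModel

open FrameModel in
/-- For any `α, β` there is a group with a frame whose `z` is nontrivial, and which maps to
`ℤ/p^s × ℤ/p^t` with `x, y` going to the standard generators. -/
theorem exists_frame {p s t : ℕ} (hp : p.Prime) (hs : 1 ≤ s) (ht : 1 ≤ t) (hs2 : p = 2 → 2 ≤ s)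
    (α β : ℤ) :
    ∃ (M : Type) (_ : Group M) (x y w z : M), IsFrame p s t α β x y w z ∧ z ≠ 1 ∧
      ∃ φ : M →* Multiplicative (ZMod (p ^ s) × ZMod (p ^ t)),
        φ x = Multiplicative.ofAdd (1, 0) ∧ φ y = Multiplicative.ofAdd (0, 1) := by
  have hps : p ∣ p ^ s := dvd_pow_self p (by omega)
  have hpt : p ∣ p ^ t := dvd_pow_self p (by omega)
  have hps2 : p ∣ (p ^ s).choose 2 := dvd_pow_choose_two hp hs hs2
  have hptZ : ((p ^ t : ℕ) : ZMod p) = 0 := (ZMod.natCast_eq_zero_iff _ _).2 hpt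
  let T : Cover p := genT p
  let e : ℤ × ZMod p × ZMod p := (1, 0, 0)
  let f : ℤ × ZMod p × ZMod p := (0, 1, 0)
  let g : ℤ × ZMod p × ZMod p := (0, 0, 1)
  -- As `T` stands for `x⁻¹`, killing `r₁` and `r₂` imposes `x ^ p ^ s = z ^ α` and `y ^ p ^ t = z ^
  -- β`. Both are central, so no further relations arise.
  let r₁ : Cover p := T ^ p ^ s * inN (α • g)
  let r₂ : Cover p := inN ((p ^ t : ℕ) • e - β • g)
  have hg (k : ℤ) : shear p (k • g) = k • g := by ext <;> simp [shear, g]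
  have hc₁ : r₁ ∈ Subgroup.center (Cover p) :=
    mul_mem (genT_pow_mem_center hps hps2) (inN_mem_center (hg α))
  have hc₂ : r₂ ∈ Subgroup.center (Cover p) := by
    apply inN_mem_center
    ext
    · simp [shear]
    · simpa [shear, e, g] using hptZ
    · simp [shear, e, g]
  let R : Subgroup (Cover p) := Subgroup.closure {r₁, r₂}
  have hRc : R ≤ Subgroup.center (Cover p) := by
    rw [Subgroup.closure_le]
    rintro u (rfl | rfl)
    exacts [hc₁, hc₂]
  have hR : R.Normal := ⟨fun n hn k => by
    rw [Subgroup.mem_center_iff.1 (hRc hn) k, mul_inv_cancel_right]; exact hn⟩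
  -- Elements of `R` are `r₁ ^ i * r₂ ^ j`. The exponents of `x` and `y` in the cover are integers,
  -- so `z`, having both exponents zero, could only be the one with `i = j = 0`.
  have hz : inN g ∉ R := by
    intro hmem
    have hcomm : Commute r₁ r₂ := (Subgroup.mem_center_iff.1 hc₂ r₁)
    obtain ⟨i, j, hij⟩ := exists_zpow_mul_zpow_of_mem_closure_pair hcomm hmem
    have hexp := congrArg (expHom p) hij
    simp only [map_mul, map_zpow, map_pow, r₁, r₂, T, expHom_genT, expHom_inN, ← ofAdd_nsmul,
      ← ofAdd_zsmul, ← ofAdd_add, Multiplicative.ofAdd.injective.eq_iff, Prod.ext_iff] at hexp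
    have hp0 := hp.ne_zero
    obtain ⟨rfl, rfl⟩ : i = 0 ∧ j = 0 := by simpa [g, e, hp0] using hexp
    rw [zpow_zero, zpow_zero, mul_one, ← inN_zero, inN_inj] at hij
    have : Fact p.Prime := ⟨hp⟩
    simp [g] at hij
  refine ⟨Cover p ⧸ R, inferInstance, ((T⁻¹ : Cover p) : Cover p ⧸ R), (inN e : Cover p),
    (inN f : Cover p), (inN g : Cover p), ?_, ?_, ?_⟩
  · have hT (v) : inN v * T⁻¹ = T⁻¹ * inN (shear p v) := by
      rw [eq_inv_mul_iff_mul_eq, ← mul_assoc, genT_conj, mul_inv_cancel_right]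
    constructor
    · rw [← QuotientGroup.mk_mul, ← QuotientGroup.mk_mul, ← QuotientGroup.mk_mul, hT, mul_assoc,
        inN_mul]
      congr 3
      ext <;> simp [shear, e, f]
    · rw [← QuotientGroup.mk_mul, ← QuotientGroup.mk_mul, ← QuotientGroup.mk_mul, hT, mul_assoc,
        inN_mul]
      congr 3
      ext <;> simp [shear, f, g]
    · rw [← QuotientGroup.mk_mul, ← QuotientGroup.mk_mul, inN_mul, inN_mul, add_comm]
    · rw [← QuotientGroup.mk_mul, ← QuotientGroup.mk_mul, hT]
      congr 3
      ext <;> simp [shear, g]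
    · rw [← QuotientGroup.mk_mul, ← QuotientGroup.mk_mul, inN_mul, inN_mul, add_comm]
    · rw [← QuotientGroup.mk_pow, inN_pow, show p • f = 0 by ext <;> simp [f], inN_zero]
      rfl
    · rw [← QuotientGroup.mk_pow, inN_pow, show p • g = 0 by ext <;> simp [g], inN_zero]
      rfl
    · rw [← QuotientGroup.mk_pow, ← QuotientGroup.mk_zpow, QuotientGroup.eq, inv_pow, inv_inv,
        inN_zpow]
      exact Subgroup.subset_closure (Set.mem_insert _ _)
    · rw [← QuotientGroup.mk_pow, ← QuotientGroup.mk_zpow, eq_comm, QuotientGroup.eq, ← zpow_neg,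
        inN_zpow, inN_pow, inN_mul, neg_smul, neg_add_eq_sub]
      exact Subgroup.subset_closure (Set.mem_insert_of_mem _ rfl)
  · rwa [Ne, QuotientGroup.eq_one_iff]
  · let π : Multiplicative (ℤ × ℤ) →* Multiplicative (ZMod (p ^ s) × ZMod (p ^ t)) :=
      AddMonoidHom.toMultiplicative
        (AddMonoidHom.prodMap (Int.castAddHom (ZMod (p ^ s))) (Int.castAddHom (ZMod (p ^ t))))
    have hπ (i j : ℤ) : π (Multiplicative.ofAdd (i, j)) =
        Multiplicative.ofAdd ((i : ZMod (p ^ s)), (j : ZMod (p ^ t))) := rfl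
    refine ⟨QuotientGroup.lift R (π.comp (expHom p)) ?_, ?_, ?_⟩
    · change R ≤ (π.comp (expHom p)).ker
      rw [Subgroup.closure_le]
      rintro u (rfl | rfl)
      · simp only [SetLike.mem_coe, MonoidHom.mem_ker, MonoidHom.comp_apply, r₁, T, map_mul, map_pow,
          expHom_genT, expHom_inN, hπ, ← ofAdd_nsmul, ← ofAdd_add]
        rw [ofAdd_eq_one]
        ext
        · simp
        · simp [g]
      · simp only [SetLike.mem_coe, MonoidHom.mem_ker, MonoidHom.comp_apply, r₂,
          expHom_inN, hπ]
        rw [ofAdd_eq_one]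
        ext
        · simp
        · simp only [Prod.fst_sub, Prod.smul_fst, e, g]
          simpa using (by exact_mod_cast ZMod.natCast_self (p ^ t) : (p : ZMod (p ^ t)) ^ t = 0)
    · change π (expHom p T⁻¹) = _
      rw [map_inv, expHom_genT, ← ofAdd_neg, Prod.neg_mk, hπ]
      simp
    · change π (expHom p (inN e)) = _
      rw [expHom_inN, hπ]
      simp [e]

/-! ### Transport along isomorphisms; reduction to non-abelian subgroups. -/

lemma IsMinimalNonabelian.of_mulEquiv {G K : Type*} [Group G] [Group K] (e : G ≃* K)
    (h : IsMinimalNonabelian G) : IsMinimalNonabelian K := by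
  obtain ⟨⟨x, y, hxy⟩, hsub⟩ := h
  refine ⟨⟨e x, e y, fun hc => hxy (e.injective (by simpa using hc))⟩, fun H hH u hu v hv => ?_⟩
  have := hsub (H.comap e.toMonoidHom)
    (fun ht => hH ?_) (e.symm u) (by simpa using hu) (e.symm v) (by simpa using hv)
  · apply e.symm.injective
    simpa using this
  · rw [← Subgroup.comap_top e.toMonoidHom] at ht
    exact Subgroup.comap_injective (f := e.toMonoidHom) e.surjective ht

lemma IsIMax.of_mulEquiv {p k : ℕ} {G K : Type*} [Group G] [Group K] (e : G ≃* K)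
    (h : IsIMax p K k) : IsIMax p G k := by
  constructor
  · obtain ⟨H, hH, hi⟩ := h.1
    refine ⟨H.comap e.toMonoidHom, hH.of_mulEquiv (e.symm.subgroupMap H |>.trans
      (MulEquiv.subgroupCongr ?_)), ?_⟩
    · exact (Subgroup.comap_equiv_eq_map_symm e H).symm
    · rw [← hi]
      exact Subgroup.index_comap_of_surjective H (f := e.toMonoidHom) e.surjective
  · rintro i ⟨H, hH, rfl⟩
    refine h.2 ⟨H.map e.toMonoidHom, hH.of_mulEquiv (e.subgroupMap H), ?_⟩
    exact Subgroup.index_map_equiv H e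

/-- In a finite group, `p ^ k` is the maximal index of the minimal non-abelian subgroups as soon as
it is the maximal index of the non-abelian subgroups. -/
lemma IsIMax.of_nonabelian {p k : ℕ} {G : Type*} [Group G] [Finite G]
    (hle : ∀ H : Subgroup G, (∃ x ∈ H, ∃ y ∈ H, x * y ≠ y * x) → H.index ≤ p ^ k)
    (H : Subgroup G) (hH : ∃ x ∈ H, ∃ y ∈ H, x * y ≠ y * x) (hi : H.index = p ^ k) :
    IsIMax p G k := by
  constructor
  · refine ⟨H, ⟨?_, fun K hK x hx y hy => ?_⟩, hi⟩
    · obtain ⟨x, hx, y, hy, hxy⟩ := hH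
      exact ⟨⟨x, hx⟩, ⟨y, hy⟩, fun hc => hxy (by simpa using congrArg Subtype.val hc)⟩
    · by_contra hxy
      -- A non-abelian proper subgroup of `H` would have index strictly above the bound `p ^ k`.
      have hlt : K.map H.subtype < H := by
        refine lt_of_le_of_ne (Subgroup.map_subtype_le K) fun heq => hK ?_
        rw [eq_top_iff]
        intro u _
        have hu : (u : G) ∈ K.map H.subtype := by
          rw [heq]
          exact u.2
        obtain ⟨v, hv, hvu⟩ := hu
        rwa [← Subtype.ext hvu]
      have h1 := hle (K.map H.subtype) ⟨x, ⟨x, hx, rfl⟩, y, ⟨y, hy, rfl⟩, fun hc =>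
        hxy (Subtype.ext hc)⟩
      have h2 := Subgroup.index_strictAnti hlt
      omega
  · rintro i ⟨K, ⟨⟨x, y, hxy⟩, -⟩, rfl⟩
    exact hle K ⟨x, x.2, y, y.2, fun hc => hxy (Subtype.ext hc)⟩

/-! ### The groups of order 81 and class 3. -/

/-- The index of a minimal non-abelian subgroup of a `3`-group of order `81` and class `3`. -/
theorem isIMax_of_card_eq_81 {G : Type*} [Group G] (hG : Nat.card G = 3 ^ 4)
    [Group.IsNilpotent G] (hc : Group.nilpotencyClass G = 3) : IsIMax 3 G 1 := by
  have : Finite G := Nat.finite_of_card_ne_zero (by rw [hG]; norm_num)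
  have h3 : Fact (Nat.Prime 3) := ⟨Nat.prime_three⟩
  have card_eq (H : Subgroup G) : ∃ k ≤ 4, Nat.card H = 3 ^ k :=
    (Nat.dvd_prime_pow Nat.prime_three).1 (hG ▸ H.card_subgroup_dvd_card)
  have comm_of_card_le {K : Type _} [Group K] {k : ℕ} (hk : k ≤ 2) (hK : Nat.card K = 3 ^ k) (x y : K) :
      x * y = y * x := by
    interval_cases k
    · have := (Nat.card_eq_one_iff_unique.1 hK).1
      exact Subsingleton.elim _ _
    · have := isCyclic_of_prime_card (p := 3) (by simpa using hK)
      exact IsCyclic.commGroup.mul_comm x y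
    · exact (IsPGroup.isMulCommutative_of_card_eq_prime_sq (p := 3) hK).is_comm.comm x y
  have not_comm : ∃ x y : G, x * y ≠ y * x := by
    by_contra! hcomm
    let _ : CommGroup G := { mul_comm := hcomm }
    have := CommGroup.nilpotencyClass_le_one (G := G)
    omega
  have exists_max (x : G) : ∃ M : Subgroup G, M.index = 3 ∧ x ∈ M := by
    obtain ⟨k, hk, hcard⟩ := card_eq (Subgroup.zpowers x)
    have hk3 : k ≤ 3 := by
      by_contra! hk'
      obtain rfl : k = 4 := by omega
      have htop : Subgroup.zpowers x = ⊤ := Subgroup.eq_top_of_card_eq _ (by rw [hcard, hG])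
      obtain ⟨u, v, huv⟩ := not_comm
      have hu : u ∈ Subgroup.zpowers x := htop ▸ Subgroup.mem_top u
      have hv : v ∈ Subgroup.zpowers x := htop ▸ Subgroup.mem_top v
      obtain ⟨i, rfl⟩ := hu
      obtain ⟨j, rfl⟩ := hv
      exact huv ((Commute.refl x).zpow_zpow i j)
    obtain ⟨M, hM, hle⟩ := Sylow.exists_subgroup_card_pow_prime_le (G := G) 3 (n := k) (m := 3)
      (by rw [hG]; norm_num) _ hcard hk3
    refine ⟨M, ?_, hle (Subgroup.mem_zpowers x)⟩
    have := M.card_mul_index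
    rw [hM, hG] at this
    omega
  -- If all maximal subgroups were abelian, two distinct ones would meet in a central subgroup of
  -- index at most `9`. Then `G` modulo its center would be abelian, so the class would be at most
  -- `2`.
  have key : ∃ M : Subgroup G, M.index = 3 ∧ ∃ x ∈ M, ∃ y ∈ M, x * y ≠ y * x := by
    by_contra! hab
    obtain ⟨x, y, hxy⟩ := not_comm
    obtain ⟨M, hM, hxM⟩ := exists_max x
    obtain ⟨N, hN, hyN⟩ := exists_max y
    have hyM : y ∉ M := fun h => hxy (hab M hM x hxM y h)
    have hsup : M ⊔ N = ⊤ := by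
      have hlt : M < M ⊔ N := lt_of_le_of_ne le_sup_left fun h => hyM (h ▸ Subgroup.mem_sup_right hyN)
      have h1 := Subgroup.index_strictAnti hlt
      have h2 := Subgroup.index_dvd_of_le hlt.le
      rw [hM] at h1 h2
      rcases (Nat.dvd_prime Nat.prime_three).1 h2 with h | h
      · exact Subgroup.index_eq_one.1 h
      · omega
    have hcen : M ⊓ N ≤ Subgroup.center G := by
      intro g hg
      have hle : M ⊔ N ≤ Subgroup.centralizer {g} := by
        refine sup_le (fun u hu => ?_) (fun u hu => ?_)
        · exact Subgroup.mem_centralizer_singleton_iff.2 (hab M hM u hu g hg.1)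
        · exact Subgroup.mem_centralizer_singleton_iff.2 (hab N hN u hu g hg.2)
      rw [Subgroup.mem_center_iff]
      intro u
      exact Subgroup.mem_centralizer_singleton_iff.1 (hle (hsup ▸ Subgroup.mem_top u))
    have hidx : (Subgroup.center G).index ≤ 9 := by
      have h1 := Subgroup.index_antitone hcen
      have h2 := Subgroup.index_inf_le (H := M) (K := N)
      rw [hM, hN] at h2
      omega
    have hdvd : (Subgroup.center G).index ∣ 3 ^ 4 := hG ▸ Subgroup.index_dvd_card _
    obtain ⟨k, -, hk⟩ := (Nat.dvd_prime_pow Nat.prime_three).1 hdvd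
    have hk2 : k ≤ 2 := by
      by_contra! hk'
      have : 3 ^ 3 ≤ 3 ^ k := Nat.pow_le_pow_right (by norm_num) hk'
      omega
    let _ : CommGroup (G ⧸ Subgroup.center G) := { mul_comm := comm_of_card_le hk2 hk }
    have h1 := CommGroup.nilpotencyClass_le_one (G := G ⧸ Subgroup.center G)
    have h2 := Group.nilpotencyClass_quotient_center (G := G)
    have h3 : Group.nilpotencyClass (G ⧸ Subgroup.center G) ≤ 1 := by convert h1
    omega
  obtain ⟨M, hM, hne⟩ := key
  refine IsIMax.of_nonabelian (fun H ⟨x, hx, y, hy, hxy⟩ => ?_) M hne (by simpa using hM)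
  obtain ⟨k, hk, hcard⟩ := card_eq H
  -- Groups of order at most `9` here are abelian, so a non-abelian subgroup has order at least
  -- `27`.
  have hk3 : 3 ≤ k := by
    by_contra! hk'
    exact hxy (congrArg Subtype.val (comm_of_card_le (by omega) hcard (⟨x, hx⟩ : H) ⟨y, hy⟩))
  have h1 := H.card_mul_index
  have h2 : 3 ^ 3 ≤ 3 ^ k := Nat.pow_le_pow_right (by norm_num) hk3
  rw [hcard, hG] at h1
  nlinarith

/-! ### Collection formulas for powers. -/

lemma mul_pow_of_commutator {G : Type*} [Group G] {a b c : G} (h : a * b = b * a * c)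
    (hcb : Commute c b) (j : ℕ) : a * b ^ j = b ^ j * a * c ^ j := by
  induction j with
  | zero => simp
  | succ j ih =>
    calc a * b ^ (j + 1) = (a * b ^ j) * b := by rw [pow_succ, mul_assoc]
      _ = b ^ j * a * (c ^ j * b) := by rw [ih]; group
      _ = b ^ j * (a * b) * c ^ j := by rw [(hcb.pow_left _).eq]; group
      _ = b ^ (j + 1) * a * c ^ (j + 1) := by
        rw [h, pow_succ b, pow_succ' c]
        simp only [mul_assoc]

lemma pow_mul_pow_of_commutator {G : Type*} [Group G] {a b c : G} (h : a * b = b * a * c)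
    (hca : Commute c a) (hcb : Commute c b) (i j : ℕ) :
    a ^ i * b ^ j = b ^ j * a ^ i * c ^ (i * j) := by
  have h1 : a ^ i * b = b * a ^ i * c ^ i := by
    induction i with
    | zero => simp
    | succ i ih =>
      calc a ^ (i + 1) * b = a ^ i * (a * b) := by rw [pow_succ, mul_assoc]
        _ = a ^ i * b * (a * c) := by rw [h]; group
        _ = b * a ^ i * (c ^ i * a) * c := by rw [ih]; group
        _ = b * a ^ (i + 1) * c ^ (i + 1) := by
          rw [(hca.pow_left i).eq, pow_succ, pow_succ]; simp only [mul_assoc]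
  rw [mul_pow_of_commutator h1 (hcb.pow_left i), pow_mul]

/-- The binomial coefficient counts the factors `z` produced when the successive `w`'s are moved
past the remaining `x`'s. -/
lemma pow_mul_of_commutators {G : Type*} [Group G] {x y w z : G} (hxy : x * y = y * x * w)
    (hwx : w * x = x * w * z) (hzx : Commute z x) (hzw : Commute z w) (i : ℕ) :
    x ^ i * y = y * x ^ i * w ^ i * z ^ i.choose 2 := by
  induction i with
  | zero => simp
  | succ i ih =>
    have h := pow_mul_pow_of_commutator hwx hzw hzx i 1
    rw [pow_one, mul_one] at h
    calc x ^ (i + 1) * y = x ^ i * (x * y) := by rw [pow_succ, mul_assoc]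
      _ = x ^ i * y * (x * w) := by rw [hxy]; group
      _ = y * x ^ i * w ^ i * (z ^ i.choose 2 * (x * w)) := by rw [ih]; group
      _ = y * x ^ i * w ^ i * ((x * w) * z ^ i.choose 2) := by
        rw [((hzx.mul_right hzw).pow_left _).eq]
      _ = y * x ^ i * (w ^ i * x) * w * z ^ i.choose 2 := by simp only [mul_assoc]
      _ = y * x ^ i * x * w ^ i * (z ^ i * w) * z ^ i.choose 2 := by
        rw [h]; simp only [mul_assoc]
      _ = y * x ^ (i + 1) * w ^ (i + 1) * z ^ (i + 1).choose 2 := by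
        rw [(hzw.pow_left i).eq, Nat.choose_succ_succ' i 1, Nat.choose_one_right, pow_add z,
          pow_succ, pow_succ]
        simp only [mul_assoc]

/-! ### Normal form and order of a group with a frame. -/

namespace IsFrame

variable {p s t : ℕ} {α β : ℤ} {G : Type*} [Group G] {x y w z : G}

lemma commute_zw (F : IsFrame p s t α β x y w z) : Commute z w := by
  have hzx : Commute z x := F.zx
  have hzy : Commute z y := F.zy
  have hw : w = (y * x)⁻¹ * (x * y) := by rw [F.xy]; group
  rw [hw]
  exact ((hzy.mul_right hzx).inv_right).mul_right (hzx.mul_right hzy)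

lemma pow_w_mul_pow_x (F : IsFrame p s t α β x y w z) (k i : ℕ) :
    w ^ k * x ^ i = x ^ i * w ^ k * z ^ (k * i) :=
  pow_mul_pow_of_commutator F.wx F.commute_zw F.zx k i

lemma pow_w_mul_x (F : IsFrame p s t α β x y w z) (k : ℕ) : w ^ k * x = x * w ^ k * z ^ k := by
  simpa using F.pow_w_mul_pow_x k 1

lemma pow_x_mul_y (F : IsFrame p s t α β x y w z) (i : ℕ) :
    x ^ i * y = y * x ^ i * w ^ i * z ^ i.choose 2 :=
  pow_mul_of_commutators F.xy F.wx F.zx F.commute_zw i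

lemma zpow_z_eq (F : IsFrame p s t α β x y w z) (hp : p ≠ 0) (k : ℤ) : ∃ l : ℕ, z ^ k = z ^ l := by
  have hpz : (0 : ℤ) < p := by exact_mod_cast Nat.pos_of_ne_zero hp
  refine ⟨(k % p).toNat, ?_⟩
  rw [← zpow_natCast, Int.toNat_of_nonneg (Int.emod_nonneg _ hpz.ne')]
  conv_lhs => rw [← Int.emod_add_mul_ediv k p, zpow_add, zpow_mul, zpow_natCast, F.zp, one_zpow,
    mul_one]

lemma pow_x_dvd (F : IsFrame p s t α β x y w z) (hp : p ≠ 0) {i : ℕ} (hi : p ^ s ∣ i) :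
    ∃ l : ℕ, x ^ i = z ^ l := by
  obtain ⟨c, rfl⟩ := hi
  rw [pow_mul, F.xs, ← zpow_natCast, ← zpow_mul]
  exact F.zpow_z_eq hp _

lemma pow_y_dvd (F : IsFrame p s t α β x y w z) (hp : p ≠ 0) {i : ℕ} (hi : p ^ t ∣ i) :
    ∃ l : ℕ, y ^ i = z ^ l := by
  obtain ⟨c, rfl⟩ := hi
  rw [pow_mul, F.yt, ← zpow_natCast, ← zpow_mul]
  exact F.zpow_z_eq hp _

lemma z_central (F : IsFrame p s t α β x y w z) (hgen : Subgroup.closure {x, y} = ⊤) (g : G) :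
    Commute z g := by
  have h : Subgroup.closure {x, y} ≤ Subgroup.centralizer {z} := by
    rw [Subgroup.closure_le]
    rintro u (rfl | rfl)
    exacts [Subgroup.mem_centralizer_singleton_iff.2 F.zx.symm,
      Subgroup.mem_centralizer_singleton_iff.2 F.zy.symm]
  exact (Subgroup.mem_centralizer_singleton_iff.1 (h (hgen ▸ Subgroup.mem_top g))).symm

lemma normal_form (F : IsFrame p s t α β x y w z) (hp : p ≠ 0)
    (hgen : Subgroup.closure {x, y} = ⊤) (g : G) :
    ∃ i j k l : ℕ, g = y ^ j * x ^ i * w ^ k * z ^ l := by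
  have hz := F.z_central hgen
  have hx (g : G) (h : ∃ i j k l : ℕ, g = y ^ j * x ^ i * w ^ k * z ^ l) :
      ∃ i j k l : ℕ, g * x = y ^ j * x ^ i * w ^ k * z ^ l := by
    obtain ⟨i, j, k, l, rfl⟩ := h
    refine ⟨i + 1, j, k, k + l, ?_⟩
    rw [mul_assoc, ((hz x).pow_left l).eq, ← mul_assoc, mul_assoc (y ^ j * x ^ i), F.pow_w_mul_x,
      pow_add z, pow_succ x]
    simp only [mul_assoc]
  have hy (g : G) (h : ∃ i j k l : ℕ, g = y ^ j * x ^ i * w ^ k * z ^ l) :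
      ∃ i j k l : ℕ, g * y = y ^ j * x ^ i * w ^ k * z ^ l := by
    obtain ⟨i, j, k, l, rfl⟩ := h
    refine ⟨i, j + 1, i + k, i.choose 2 + l, ?_⟩
    have hwy : Commute w y := F.wy
    rw [mul_assoc, ((hz y).pow_left l).eq, ← mul_assoc, mul_assoc (y ^ j * x ^ i),
      (hwy.pow_left k).eq, ← mul_assoc, mul_assoc (y ^ j), F.pow_x_mul_y]
    rw [mul_assoc (y ^ j), mul_assoc (y ^ j), mul_assoc _ (z ^ i.choose 2),
      ((hz (w ^ k)).pow_left _).eq]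
    simp only [pow_add, pow_succ, mul_assoc]
  have iter {u : G} (hu : ∀ g : G, (∃ i j k l : ℕ, g = y ^ j * x ^ i * w ^ k * z ^ l) →
      ∃ i j k l : ℕ, g * u = y ^ j * x ^ i * w ^ k * z ^ l) (N : ℕ) (g : G)
      (h : ∃ i j k l : ℕ, g = y ^ j * x ^ i * w ^ k * z ^ l) :
      ∃ i j k l : ℕ, g * u ^ N = y ^ j * x ^ i * w ^ k * z ^ l := by
    induction N with
    | zero => simpa using h
    | succ N ih => rw [pow_succ, ← mul_assoc]; exact hu _ ih
  -- The generators have finite order, so their inverses are positive powers and natural exponents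
  -- suffice.
  have inv_eq {u : G} {N : ℕ} (hN : N ≠ 0) (hu : (u ^ N) ^ p = 1) : u⁻¹ = u ^ (N * p - 1) := by
    rw [inv_eq_iff_mul_eq_one, ← pow_succ', Nat.sub_add_cancel, pow_mul, hu]
    exact Nat.one_le_iff_ne_zero.2 (mul_ne_zero hN hp)
  have hzp (k : ℤ) : (z ^ k) ^ p = 1 := by
    rw [← zpow_natCast, ← zpow_mul, mul_comm, zpow_mul, zpow_natCast, F.zp, one_zpow]
  have hg : g ∈ Subgroup.closure {x, y} := hgen ▸ Subgroup.mem_top g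
  induction hg using Subgroup.closure_induction_right with
  | one => exact ⟨0, 0, 0, 0, by simp⟩
  | mul_right g u _ hu ih =>
    rcases hu with rfl | rfl
    exacts [hx _ ih, hy _ ih]
  | mul_inv_cancel g u _ hu ih =>
    rcases hu with rfl | rfl
    · rw [inv_eq (pow_ne_zero s hp) (by rw [F.xs]; exact hzp α)]
      exact iter hx _ _ ih
    · rw [inv_eq (pow_ne_zero t hp) (by rw [F.yt]; exact hzp β)]
      exact iter hy _ _ ih

/-- An upper bound for the order is enough: it is only compared with lower bounds for orders of
subgroups. -/
lemma finite_and_card_le (F : IsFrame p s t α β x y w z) (hp : p ≠ 0)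
    (hgen : Subgroup.closure {x, y} = ⊤) : Finite G ∧ Nat.card G ≤ p ^ (s + t + 2) := by
  have hz := F.z_central hgen
  have : NeZero p := ⟨hp⟩
  let Φ : Fin (p ^ s) × Fin (p ^ t) × Fin p × Fin p → G := fun v =>
    y ^ (v.2.1 : ℕ) * x ^ (v.1 : ℕ) * w ^ (v.2.2.1 : ℕ) * z ^ (v.2.2.2 : ℕ)
  have hΦ : Function.Surjective Φ := by
    intro g
    obtain ⟨i, j, k, l, rfl⟩ := F.normal_form hp hgen g
    have hpp := Nat.pos_of_ne_zero hp
    obtain ⟨l₁, h₁⟩ := F.pow_x_dvd hp (dvd_mul_right (p ^ s) (i / p ^ s))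
    obtain ⟨l₂, h₂⟩ := F.pow_y_dvd hp (dvd_mul_right (p ^ t) (j / p ^ t))
    have hx : x ^ i = x ^ (i % p ^ s) * z ^ l₁ := by rw [← h₁, ← pow_add, Nat.mod_add_div]
    have hy : y ^ j = y ^ (j % p ^ t) * z ^ l₂ := by rw [← h₂, ← pow_add, Nat.mod_add_div]
    have hw : w ^ k = w ^ (k % p) := pow_eq_pow_mod k F.wp
    refine ⟨⟨⟨_, Nat.mod_lt i (pow_pos hpp s)⟩, ⟨_, Nat.mod_lt j (pow_pos hpp t)⟩,
      ⟨_, Nat.mod_lt k hpp⟩, ⟨_, Nat.mod_lt (l₂ + (l₁ + l)) hpp⟩⟩, ?_⟩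
    simp only [Φ]
    have e (n a : ℕ) (g u : G) : z ^ n * (g ^ a * u) = g ^ a * (z ^ n * u) :=
      ((hz (g ^ a)).pow_left n).left_comm u
    rw [← hw, ← pow_eq_pow_mod _ F.zp, hx, hy, pow_add, pow_add]
    simp only [mul_assoc, e _ _ x, e _ _ w]
  have hfin : Finite G := Finite.of_surjective Φ hΦ
  refine ⟨hfin, (Nat.card_le_card_of_surjective Φ hΦ).trans_eq ?_⟩
  simp [pow_add, pow_two, mul_assoc]

/-- This identifies the kernel of `φ` with `⟨w, z⟩`. Commutators lie in that kernel, as does any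
difference between two elements with the same image. -/
lemma eq_of_mem_ker (F : IsFrame p s t α β x y w z) (hp : p ≠ 0)
    (hgen : Subgroup.closure {x, y} = ⊤)
    {φ : G →* Multiplicative (ZMod (p ^ s) × ZMod (p ^ t))}
    (hφ : ∀ i j k l : ℕ, φ (y ^ j * x ^ i * w ^ k * z ^ l) =
      Multiplicative.ofAdd ((i : ZMod (p ^ s)), (j : ZMod (p ^ t)))) {g : G}
    (hg : φ g = 1) : ∃ k l : ℕ, g = w ^ k * z ^ l := by
  have hz := F.z_central hgen
  obtain ⟨i, j, k, l, rfl⟩ := F.normal_form hp hgen g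
  rw [hφ, ofAdd_eq_one, Prod.ext_iff] at hg
  obtain ⟨l₁, h₁⟩ := F.pow_x_dvd hp ((ZMod.natCast_eq_zero_iff _ _).1 hg.1)
  obtain ⟨l₂, h₂⟩ := F.pow_y_dvd hp ((ZMod.natCast_eq_zero_iff _ _).1 hg.2)
  refine ⟨k, l₂ + l₁ + l, ?_⟩
  rw [h₁, h₂, ← pow_add, ((hz (w ^ k)).pow_left _).eq, pow_add _ _ l, mul_assoc]

lemma map_w (F : IsFrame p s t α β x y w z) {A : Type*} [CommGroup A] (φ : G →* A) : φ w = 1 := by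
  have := congrArg φ F.xy
  rwa [map_mul, map_mul, map_mul, mul_comm (φ x), left_eq_mul] at this

lemma map_z (F : IsFrame p s t α β x y w z) {A : Type*} [CommGroup A] (φ : G →* A) : φ z = 1 := by
  have := congrArg φ F.wx
  rwa [map_mul, map_mul, map_mul, mul_comm (φ w), left_eq_mul] at this

lemma map_normal_form (F : IsFrame p s t α β x y w z)
    {φ : G →* Multiplicative (ZMod (p ^ s) × ZMod (p ^ t))}
    (hφx : φ x = Multiplicative.ofAdd (1, 0)) (hφy : φ y = Multiplicative.ofAdd (0, 1))
    (i j k l : ℕ) : φ (y ^ j * x ^ i * w ^ k * z ^ l) =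
      Multiplicative.ofAdd ((i : ZMod (p ^ s)), (j : ZMod (p ^ t))) := by
  simp only [map_mul, map_pow, F.map_w, F.map_z, one_pow, mul_one, hφx, hφy, ← ofAdd_nsmul,
    ← ofAdd_add]
  simp

end IsFrame

/-! ### Subgroups not centralizing the derived subgroup. -/

lemma mem_of_pow_mem_of_pow_prime_eq_one {G : Type*} [Group G] {p : ℕ} (hp : p.Prime) {z : G}
    (hz : z ^ p = 1) {l : ℕ} (hl : ¬ p ∣ l) {H : Subgroup G} (h : z ^ l ∈ H) : z ∈ H := by
  have hc : IsCoprime (l : ℤ) p := Nat.isCoprime_iff_coprime.2 ((hp.coprime_iff_not_dvd.2 hl).symm)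
  obtain ⟨a, b, hab⟩ := hc
  have : z = (z ^ l) ^ a := by
    conv_lhs => rw [← zpow_one z, ← hab, zpow_add, mul_comm a, zpow_mul, mul_comm b, zpow_mul,
      zpow_natCast, zpow_natCast, hz, one_zpow, mul_one]
  rw [this]
  exact zpow_mem h a

namespace IsFrame

variable {p s t : ℕ} {α β : ℤ} {G : Type*} [Group G] {x y w z : G}

lemma pow_eq_one_of_mem_ker (F : IsFrame p s t α β x y w z) (k l : ℕ) :
    (w ^ k * z ^ l) ^ p = 1 := by
  rw [((F.commute_zw.pow_pow l k).symm).mul_pow, ← pow_mul, ← pow_mul, mul_comm k, mul_comm l, pow_mul,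
    pow_mul, F.wp, F.zp, one_pow, one_pow, mul_one]

lemma isPGroup (F : IsFrame p s t α β x y w z) (hp : p.Prime)
    (hgen : Subgroup.closure {x, y} = ⊤)
    {φ : G →* Multiplicative (ZMod (p ^ s) × ZMod (p ^ t))}
    (hφx : φ x = Multiplicative.ofAdd (1, 0)) (hφy : φ y = Multiplicative.ofAdd (0, 1)) :
    IsPGroup p G := by
  intro g
  refine ⟨s + t + 1, ?_⟩
  have hg : φ (g ^ p ^ (s + t)) = 1 := by
    rw [map_pow, ← toAdd_eq_zero, toAdd_pow]
    ext
    · simp [pow_add, show ((p : ZMod (p ^ s)) ^ s) = 0 by exact_mod_cast ZMod.natCast_self (p ^ s)]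
    · simp [pow_add, show ((p : ZMod (p ^ t)) ^ t) = 0 by exact_mod_cast ZMod.natCast_self (p ^ t)]
  obtain ⟨k, l, hkl⟩ := F.eq_of_mem_ker hp.ne_zero hgen (F.map_normal_form hφx hφy) hg
  rw [pow_succ, pow_mul, hkl, F.pow_eq_one_of_mem_ker]

lemma exists_commutator (F : IsFrame p s t α β x y w z) (hp : p.Prime)
    (hgen : Subgroup.closure {x, y} = ⊤)
    {φ : G →* Multiplicative (ZMod (p ^ s) × ZMod (p ^ t))}
    (hφx : φ x = Multiplicative.ofAdd (1, 0)) (hφy : φ y = Multiplicative.ofAdd (0, 1))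
    {H : Subgroup G} (hH : ∃ u ∈ H, ∃ v ∈ H, u * v ≠ v * u) :
    ∃ k l : ℕ, w ^ k * z ^ l ∈ H ∧ w ^ k * z ^ l ≠ 1 := by
  obtain ⟨u, hu, v, hv, huv⟩ := hH
  have hc : φ ((v * u)⁻¹ * (u * v)) = 1 := by
    simp only [map_mul, map_inv]
    rw [mul_comm (φ v), inv_mul_cancel]
  obtain ⟨k, l, hkl⟩ := F.eq_of_mem_ker hp.ne_zero hgen (F.map_normal_form hφx hφy) hc
  refine ⟨k, l, ?_, ?_⟩
  · rw [← hkl]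
    exact mul_mem (inv_mem (mul_mem hv hu)) (mul_mem hu hv)
  · rw [← hkl, Ne, inv_mul_eq_one]
    exact fun h => huv h.symm

/-- `H` contains a nontrivial commutator `w ^ k' * z ^ l'`. If `p ∣ k'` it is a nontrivial power of
`z`; otherwise its commutator with the given element is `z ^ (k' * i)`, whose exponent is prime to
`p`. -/
lemma z_mem (F : IsFrame p s t α β x y w z) (hp : p.Prime) (hgen : Subgroup.closure {x, y} = ⊤)
    {φ : G →* Multiplicative (ZMod (p ^ s) × ZMod (p ^ t))}
    (hφx : φ x = Multiplicative.ofAdd (1, 0)) (hφy : φ y = Multiplicative.ofAdd (0, 1))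
    {H : Subgroup G} (hH : ∃ u ∈ H, ∃ v ∈ H, u * v ≠ v * u) {i j k l : ℕ}
    (hh : y ^ j * x ^ i * w ^ k * z ^ l ∈ H) (hi : ¬ p ∣ i) : z ∈ H := by
  have hz := F.z_central hgen
  obtain ⟨k', l', hmem, hne⟩ := F.exists_commutator hp hgen hφx hφy hH
  by_cases hk : p ∣ k'
  · obtain ⟨c, rfl⟩ := hk
    rw [pow_mul, F.wp, one_pow, one_mul] at hmem hne
    refine mem_of_pow_mem_of_pow_prime_eq_one hp F.zp (fun hl => hne ?_) hmem
    obtain ⟨d, rfl⟩ := hl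
    rw [pow_mul, F.zp, one_pow]
  · have hwy : Commute w y := F.wy
    set h := y ^ j * x ^ i * w ^ k * z ^ l with hdef
    have h1 : w ^ k' * h = h * w ^ k' * z ^ (k' * i) := by
      calc w ^ k' * h = (w ^ k' * y ^ j) * x ^ i * w ^ k * z ^ l := by
            rw [hdef]; simp only [mul_assoc]
        _ = y ^ j * (w ^ k' * x ^ i) * w ^ k * z ^ l := by
          rw [(hwy.pow_pow k' j).eq]; simp only [mul_assoc]
        _ = y ^ j * x ^ i * w ^ k' * (z ^ (k' * i) * (w ^ k * z ^ l)) := by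
          rw [F.pow_w_mul_pow_x]; simp only [mul_assoc]
        _ = y ^ j * x ^ i * (w ^ k' * (w ^ k * z ^ l)) * z ^ (k' * i) := by
          rw [((hz _).pow_left _).eq]; simp only [mul_assoc]
        _ = h * w ^ k' * z ^ (k' * i) := by
          rw [(((Commute.refl w).pow_pow k' k).mul_right ((hz _).pow_pow l k').symm).eq, hdef]
          simp only [mul_assoc]
    have h2 : z ^ (k' * i) = (h * (w ^ k' * z ^ l'))⁻¹ * ((w ^ k' * z ^ l') * h) := by
      rw [eq_inv_mul_iff_mul_eq, mul_assoc (w ^ k'), ((hz h).pow_left l').eq, ← mul_assoc (w ^ k'), h1,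
        mul_assoc (h * w ^ k'), ((Commute.refl z).pow_pow (k' * i) l').eq]
      simp only [mul_assoc]
    refine mem_of_pow_mem_of_pow_prime_eq_one hp F.zp (l := k' * i) ?_ ?_
    · exact fun hd => (hp.dvd_mul.1 hd).elim hk hi
    · rw [h2]
      exact mul_mem (inv_mem (mul_mem hh hmem)) (mul_mem hmem hh)

/-- A non-abelian subgroup not centralizing the derived subgroup has index at most `p ^ t`. -/
lemma index_le_of_not_dvd (F : IsFrame p s t α β x y w z) (hp : p.Prime)
    (hgen : Subgroup.closure {x, y} = ⊤) (hz1 : z ≠ 1)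
    {φ : G →* Multiplicative (ZMod (p ^ s) × ZMod (p ^ t))}
    (hφx : φ x = Multiplicative.ofAdd (1, 0)) (hφy : φ y = Multiplicative.ofAdd (0, 1))
    {H : Subgroup G} (hH : ∃ u ∈ H, ∃ v ∈ H, u * v ≠ v * u) {i j k l : ℕ}
    (hh : y ^ j * x ^ i * w ^ k * z ^ l ∈ H) (hi : ¬ p ∣ i) : H.index ≤ p ^ t := by
  have hz := F.z_central hgen
  have : Fact p.Prime := ⟨hp⟩
  have : NeZero (p ^ s) := ⟨pow_ne_zero s hp.ne_zero⟩
  obtain ⟨hfin, hcard⟩ := F.finite_and_card_le hp.ne_zero hgen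
  have hzH := F.z_mem hp hgen hφx hφy hH hh hi
  have hφ := F.map_normal_form hφx hφy
  set h := y ^ j * x ^ i * w ^ k * z ^ l with hdef
  let φ₁ : G →* Multiplicative (ZMod (p ^ s)) :=
    (AddMonoidHom.toMultiplicative (AddMonoidHom.fst _ _)).comp φ
  have hφ₁h : φ₁ h = Multiplicative.ofAdd (i : ZMod (p ^ s)) := by
    change AddMonoidHom.toMultiplicative (AddMonoidHom.fst _ _) (φ h) = _
    rw [hφ]
    rfl
  have hφ₁z : φ₁ z = 1 := F.map_z φ₁
  have hpow (c : Multiplicative (ZMod (p ^ s))) : ∃ e : ℕ, φ₁ (h ^ e) = c := by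
    have hcop : Nat.Coprime i (p ^ s) := ((hp.coprime_iff_not_dvd.2 hi).symm).pow_right s
    refine ⟨((i : ZMod (p ^ s))⁻¹ * c.toAdd).val, ?_⟩
    rw [map_pow, hφ₁h, ← ofAdd_nsmul, nsmul_eq_mul, ZMod.natCast_val, ZMod.cast_id', id, mul_right_comm,
      mul_comm _ (i : ZMod (p ^ s)), ZMod.coe_mul_inv_eq_one i hcop, one_mul, ofAdd_toAdd]
  let f : H →* Multiplicative (ZMod (p ^ s)) := φ₁.comp H.subtype
  have hf : Function.Surjective f := fun c => by
    obtain ⟨e, he⟩ := hpow c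
    exact ⟨⟨h ^ e, pow_mem hh e⟩, he⟩
  have hidx : f.ker.index = p ^ s := by
    rw [Subgroup.index_ker, MonoidHom.range_eq_top.2 hf, Subgroup.card_top]
    simp
  obtain ⟨n, hn⟩ := IsPGroup.iff_card.1
    (((F.isPGroup hp hgen hφx hφy).to_subgroup H).to_subgroup f.ker)
  -- The kernel of `f` contains `z`. If it were just `⟨z⟩`, then `H` would consist of products of
  -- powers of the central `z` and of `h`, and be abelian.
  have hn2 : 2 ≤ n := by
    by_contra! hn2
    let ζ : f.ker := ⟨⟨z, hzH⟩, hφ₁z⟩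
    have hζ : orderOf ζ = p := by
      refine orderOf_eq_prime ?_ ?_
      · exact Subtype.ext (Subtype.ext F.zp)
      · exact fun h1 => hz1 (congrArg (fun v : f.ker => ((v : H) : G)) h1)
    have hdvd : p ∣ p ^ n := by
      have := orderOf_dvd_natCard ζ
      rwa [hζ, hn] at this
    have hn1 : n = 1 := by
      interval_cases n
      · exact absurd (by simpa using hdvd) hp.one_lt.ne'
      · rfl
    have htop : Subgroup.zpowers ζ = ⊤ := by
      apply Subgroup.eq_top_of_card_eq
      rw [Nat.card_zpowers, hζ, hn, hn1, pow_one]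
    have hform (u : G) (hu : u ∈ H) : ∃ (a : ℤ) (e : ℕ), u = z ^ a * h ^ e := by
      obtain ⟨e, he⟩ := hpow (φ₁ u)
      have hk : (⟨u * (h ^ e)⁻¹, mul_mem hu (inv_mem (pow_mem hh e))⟩ : H) ∈ f.ker := by
        rw [MonoidHom.mem_ker]
        change φ₁ (u * (h ^ e)⁻¹) = 1
        rw [map_mul, map_inv, he, mul_inv_cancel]
      have hmem : (⟨_, hk⟩ : f.ker) ∈ Subgroup.zpowers ζ := htop ▸ Subgroup.mem_top _
      obtain ⟨a, ha⟩ := hmem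
      have ha' : z ^ a = u * (h ^ e)⁻¹ := congrArg (fun v : f.ker => ((v : H) : G)) ha
      exact ⟨a, e, by rw [ha', inv_mul_cancel_right]⟩
    obtain ⟨u, hu, v, hv, huv⟩ := hH
    obtain ⟨a, e, rfl⟩ := hform u hu
    obtain ⟨a', e', rfl⟩ := hform v hv
    refine huv ?_
    have c1 : Commute (z ^ a) (z ^ a' * h ^ e') := (hz _).zpow_left a
    have c2 : Commute (h ^ e) (z ^ a' * h ^ e') :=
      (((hz _).zpow_left a').symm).mul_right ((Commute.refl h).pow_pow e e')
    exact (c1.mul_left c2).eq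
  have h1 := f.ker.card_mul_index
  rw [hn, hidx] at h1
  have h2 := H.card_mul_index
  rw [← h1] at h2
  have hpp := hp.pos
  have h3 : p ^ 2 ≤ p ^ n := Nat.pow_le_pow_right hpp hn2
  -- `H` has order `p ^ n * p ^ s` with `n ≥ 2`, inside a group of order at most `p ^ (s + t + 2)`.
  have h4 : p ^ 2 * p ^ s * H.index ≤ p ^ 2 * p ^ s * p ^ t := by
    calc p ^ 2 * p ^ s * H.index ≤ p ^ n * p ^ s * H.index := by gcongr
      _ ≤ p ^ (s + t + 2) := h2 ▸ hcard
      _ = p ^ 2 * p ^ s * p ^ t := by ring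
  exact Nat.le_of_mul_le_mul_left h4 (by positivity)

end IsFrame

/-! ### Subgroups centralizing the derived subgroup, and the maximal index. -/

namespace IsFrame

variable {p s t : ℕ} {α β : ℤ} {G : Type*} [Group G] {x y w z : G}

/-- For odd `p` the centralizer of the derived subgroup is abelian. -/
lemma commute_of_dvd (F : IsFrame p s t α β x y w z) (hp : Odd p)
    (hgen : Subgroup.closure {x, y} = ⊤) {i i' : ℕ} (hi : p ∣ i) (hi' : p ∣ i')
    (j k l j' k' l' : ℕ) :
    Commute (y ^ j * x ^ i * w ^ k * z ^ l) (y ^ j' * x ^ i' * w ^ k' * z ^ l') := by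
  have hz := F.z_central hgen
  have hwy : Commute w y := F.wy
  -- For odd `p`, both exponents in `[x ^ i, y] = w ^ i * z ^ i.choose 2` are divisible by `p`.
  have hxy {i : ℕ} (hi : p ∣ i) : Commute (x ^ i) y := by
    have h := F.pow_x_mul_y i
    obtain ⟨c, hc⟩ := dvd_choose_two_of_odd hp hi
    obtain ⟨d, rfl⟩ := hi
    rwa [hc, pow_mul w, pow_mul z, F.wp, F.zp, one_pow, one_pow, mul_one, mul_one] at h
  have hxw {i : ℕ} (hi : p ∣ i) : Commute w (x ^ i) := by
    have h := F.pow_w_mul_pow_x 1 i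
    obtain ⟨d, rfl⟩ := hi
    rwa [one_mul, pow_mul z, F.zp, one_pow, mul_one, pow_one] at h
  have hxx : Commute (x ^ i) (x ^ i') := (Commute.refl x).pow_pow i i'
  have aux {u : G} (h1 : Commute u y) (h2 : Commute u (x ^ i')) (h3 : Commute u w) :
      Commute u (y ^ j' * x ^ i' * w ^ k' * z ^ l') :=
    (((h1.pow_right j').mul_right h2).mul_right (h3.pow_right k')).mul_right
      ((hz u).symm.pow_right l')
  refine (((Commute.pow_left ?_ j).mul_left ?_).mul_left (Commute.pow_left ?_ k)).mul_left
    ((hz _).pow_left l)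
  · exact aux (Commute.refl y) (hxy hi').symm hwy.symm
  · exact aux (hxy hi) hxx (hxw hi).symm
  · exact aux hwy (hxw hi') (Commute.refl w)

lemma sq_x_mul_y (F : IsFrame 2 s t α β x y w z) : x ^ 2 * y = y * x ^ 2 * z := by
  have h := F.pow_x_mul_y 2
  rwa [F.wp, mul_one, Nat.choose_self, pow_one] at h

lemma commute_w_sq_x (F : IsFrame 2 s t α β x y w z) : Commute w (x ^ 2) := by
  have h := F.pow_w_mul_pow_x 1 2
  rwa [one_mul, F.zp, mul_one, pow_one] at h

/-- Here `x ^ 2` commutes with `w` and `[x ^ 2, y] = z` is central, so these elements multiply as in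
a Heisenberg group. -/
lemma mul_of_even (F : IsFrame 2 s t α β x y w z) (hgen : Subgroup.closure {x, y} = ⊤)
    (i j k l i' j' k' l' : ℕ) :
    (y ^ j * (x ^ 2) ^ i * w ^ k * z ^ l) * (y ^ j' * (x ^ 2) ^ i' * w ^ k' * z ^ l') =
      y ^ (j + j') * (x ^ 2) ^ (i + i') * w ^ (k + k') * z ^ (l + l') * z ^ (i * j') := by
  have hz := F.z_central hgen
  have hwy : Commute w y := F.wy
  have hwx := F.commute_w_sq_x
  have e (n a : ℕ) (g u : G) : z ^ n * (g ^ a * u) = g ^ a * (z ^ n * u) :=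
    ((hz (g ^ a)).pow_left n).left_comm u
  have e1 (u : G) : (x ^ 2) ^ i * (y ^ j' * u) = y ^ j' * ((x ^ 2) ^ i * (z ^ (i * j') * u)) := by
    rw [← mul_assoc, pow_mul_pow_of_commutator F.sq_x_mul_y ((hz _).pow_right 2) F.zy]
    simp only [mul_assoc]
  have e2 (u : G) : w ^ k * (y ^ j' * u) = y ^ j' * (w ^ k * u) := (hwy.pow_pow k j').left_comm u
  have e3 (u : G) : w ^ k * ((x ^ 2) ^ i' * u) = (x ^ 2) ^ i' * (w ^ k * u) :=
    (hwx.pow_pow k i').left_comm u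
  have e4 : z ^ (i * j') * (z ^ l * z ^ l') = z ^ l * (z ^ l' * z ^ (i * j')) := by
    simp only [← pow_add]
    congr 1
    omega
  simp only [pow_add, mul_assoc, e _ _ y, e _ _ (x ^ 2), e _ _ w, e1, e2, e3, e4]

/-- For `p = 2` a non-abelian subgroup centralizing the derived subgroup has index at most `4`. -/
lemma index_le_four (F : IsFrame 2 s t α β x y w z) (hgen : Subgroup.closure {x, y} = ⊤)
    {φ : G →* Multiplicative (ZMod (2 ^ s) × ZMod (2 ^ t))}
    (hφx : φ x = Multiplicative.ofAdd (1, 0)) (hφy : φ y = Multiplicative.ofAdd (0, 1))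
    {H : Subgroup G} {i j k l i' j' k' l' : ℕ}
    (hu : y ^ j * x ^ (2 * i) * w ^ k * z ^ l ∈ H)
    (hv : y ^ j' * x ^ (2 * i') * w ^ k' * z ^ l' ∈ H)
    (huv : (y ^ j * x ^ (2 * i) * w ^ k * z ^ l) * (y ^ j' * x ^ (2 * i') * w ^ k' * z ^ l') ≠
      (y ^ j' * x ^ (2 * i') * w ^ k' * z ^ l') * (y ^ j * x ^ (2 * i) * w ^ k * z ^ l)) :
    H.index ≤ 4 := by
  have hz := F.z_central hgen
  have hφ := F.map_normal_form hφx hφy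
  have hφu := hφ (2 * i) j k l
  have hφv := hφ (2 * i') j' k' l'
  have huvm := F.mul_of_even hgen i j k l i' j' k' l'
  have hvum := F.mul_of_even hgen i' j' k' l' i j k l
  rw [add_comm j', add_comm i', add_comm k', add_comm l'] at hvum
  rw [← pow_mul, ← pow_mul] at huvm hvum
  set u := y ^ j * x ^ (2 * i) * w ^ k * z ^ l with hudef
  set v := y ^ j' * x ^ (2 * i') * w ^ k' * z ^ l' with hvdef
  -- The determinant of the exponents: `[u, v] = z ^ d`. Non-commutation makes it odd, hence
  -- invertible modulo `2 ^ s` and `2 ^ t`, with inverse `e`.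
  set d : ℤ := i * j' - i' * j with hd
  have hzd : z ^ d ∈ H := by
    have : z ^ d = (v * u)⁻¹ * (u * v) := by
      rw [huvm, hvum, hd, zpow_sub, ← Nat.cast_mul, ← Nat.cast_mul, zpow_natCast, zpow_natCast, mul_inv_rev,
        mul_assoc, inv_mul_cancel_left, ((Commute.refl z).pow_pow (i * j') (i' * j)).inv_right.eq]
    rw [this]
    exact mul_mem (inv_mem (mul_mem hv hu)) (mul_mem hu hv)
  have hodd : Odd d := by
    by_contra hev
    rw [Int.not_odd_iff_even, hd] at hev
    refine huv ?_
    have hmod : (i * j') % 2 = (i' * j) % 2 := by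
      obtain ⟨c, hc⟩ := hev
      have : ((i * j' : ℕ) : ℤ) - ((i' * j : ℕ) : ℤ) = c + c := by push_cast; exact hc
      omega
    rw [huvm, hvum, pow_eq_pow_mod (i * j') F.zp, pow_eq_pow_mod (i' * j) F.zp, hmod]
  have hzH : z ∈ H := by
    obtain ⟨c, hc⟩ := hodd
    rwa [hc, zpow_add, zpow_mul, zpow_ofNat, F.zp, one_zpow, one_mul, zpow_one] at hzd
  obtain ⟨e, f, hef⟩ : ∃ e f : ℤ, e * d + f * 2 ^ (s + t) = 1 := by
    have : IsCoprime d 2 := by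
      obtain ⟨c, hc⟩ := hodd
      exact ⟨1, -c, by rw [hc]; ring⟩
    exact this.pow_right
  have hs : ((2 : ZMod (2 ^ s)) ^ s) = 0 := by exact_mod_cast ZMod.natCast_self (2 ^ s)
  have ht : ((2 : ZMod (2 ^ t)) ^ t) = 0 := by exact_mod_cast ZMod.natCast_self (2 ^ t)
  have hes : ((e : ZMod (2 ^ s)) * ((i * j' - i' * j : ℤ) : ZMod (2 ^ s))) = 1 := by
    have := congrArg (Int.cast : ℤ → ZMod (2 ^ s)) hef
    push_cast at this
    rwa [pow_add, hs, zero_mul, mul_zero, add_zero] at this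
  have het : ((e : ZMod (2 ^ t)) * ((i * j' - i' * j : ℤ) : ZMod (2 ^ t))) = 1 := by
    have := congrArg (Int.cast : ℤ → ZMod (2 ^ t)) hef
    push_cast at this
    rwa [pow_add, ht, mul_zero, mul_zero, add_zero] at this
  push_cast at hes het
  -- Cramer's rule: `A` and `B` agree with `x ^ 2` and `y` modulo the derived subgroup.
  let A := u ^ (e * j') * v ^ (-(e * j))
  let B := u ^ (-(e * i')) * v ^ (e * i)
  have hA : A ∈ H := mul_mem (zpow_mem hu _) (zpow_mem hv _)
  have hB : B ∈ H := mul_mem (zpow_mem hu _) (zpow_mem hv _)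
  have hφA : φ A = Multiplicative.ofAdd (2, 0) := by
    simp only [A, map_mul, map_zpow, hφu, hφv, ← ofAdd_zsmul, ← ofAdd_add]
    congr 1
    ext
    · simp
      linear_combination 2 * hes
    · simp
      ring
  have hφB : φ B = Multiplicative.ofAdd (0, 1) := by
    simp only [B, map_mul, map_zpow, hφu, hφv, ← ofAdd_zsmul, ← ofAdd_add]
    congr 1
    ext
    · simp
      ring
    · simp
      linear_combination het
  -- Since `H` contains `A`, `B` and `z`, the four elements `x ^ a * w ^ c` with `a, c ∈ {0, 1}`
  -- meet every left coset.
  let Φ : Fin 2 × Fin 2 → G ⧸ H := fun c => ((x ^ (c.1 : ℕ) * w ^ (c.2 : ℕ) : G) : G ⧸ H)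
  have hΦ : Function.Surjective Φ := by
    intro q
    induction q using QuotientGroup.induction_on with
    | H g =>
    obtain ⟨a, b, c, m, rfl⟩ := F.normal_form two_ne_zero hgen g
    set g := y ^ b * x ^ a * w ^ c * z ^ m with hg
    have hker : φ ((x ^ (a % 2))⁻¹ * g * (A ^ (a / 2) * B ^ b)⁻¹) = 1 := by
      simp only [map_mul, map_inv, map_pow, hg, hφ, hφA, hφB, hφx, ← ofAdd_nsmul, ← ofAdd_add,
        ← ofAdd_neg]
      rw [ofAdd_eq_one]
      have ha : (a : ZMod (2 ^ s)) = (a % 2 : ℕ) + (a / 2 : ℕ) * 2 := by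
        exact_mod_cast congrArg Nat.cast (Nat.mod_add_div' a 2).symm
      ext
      · simp only [Prod.fst_add, Prod.fst_neg, Prod.smul_fst, Prod.fst_zero, ha]
        simp only [nsmul_eq_mul]
        ring
      · simp
    obtain ⟨c', m', hcm⟩ := F.eq_of_mem_ker two_ne_zero hgen hφ hker
    refine ⟨⟨⟨a % 2, Nat.mod_lt _ two_pos⟩, ⟨c' % 2, Nat.mod_lt _ two_pos⟩⟩, ?_⟩
    simp only [Φ]
    rw [QuotientGroup.eq, ← pow_eq_pow_mod _ F.wp]
    have : (x ^ (a % 2) * w ^ c')⁻¹ * g = z ^ m' * (A ^ (a / 2) * B ^ b) := by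
      rw [mul_inv_eq_iff_eq_mul, inv_mul_eq_iff_eq_mul] at hcm
      rw [hcm]
      group
    rw [this]
    exact mul_mem (pow_mem hzH _) (mul_mem (pow_mem hA _) (pow_mem hB _))
  have := Nat.card_le_card_of_surjective Φ hΦ
  simpa [Subgroup.index] using this

lemma index_le (F : IsFrame p s t α β x y w z) (hp : p.Prime)
    (hgen : Subgroup.closure {x, y} = ⊤) (hz1 : z ≠ 1)
    {φ : G →* Multiplicative (ZMod (p ^ s) × ZMod (p ^ t))}
    (hφx : φ x = Multiplicative.ofAdd (1, 0)) (hφy : φ y = Multiplicative.ofAdd (0, 1))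
    (H : Subgroup G) (hH : ∃ u ∈ H, ∃ v ∈ H, u * v ≠ v * u) :
    H.index ≤ p ^ t ∨ p = 2 ∧ H.index ≤ 4 := by
  by_cases h : ∃ i j k l : ℕ, y ^ j * x ^ i * w ^ k * z ^ l ∈ H ∧ ¬ p ∣ i
  · obtain ⟨i, j, k, l, hh, hi⟩ := h
    exact Or.inl (F.index_le_of_not_dvd hp hgen hz1 hφx hφy hH hh hi)
  · push Not at h
    obtain ⟨u, hu, v, hv, huv⟩ := hH
    obtain ⟨i, j, k, l, rfl⟩ := F.normal_form hp.ne_zero hgen u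
    obtain ⟨i', j', k', l', rfl⟩ := F.normal_form hp.ne_zero hgen v
    have hi := h _ _ _ _ hu
    have hi' := h _ _ _ _ hv
    rcases hp.eq_two_or_odd' with rfl | hodd
    · obtain ⟨a, rfl⟩ := hi
      obtain ⟨a', rfl⟩ := hi'
      exact Or.inr ⟨rfl, F.index_le_four hgen hφx hφy hu hv huv⟩
    · exact absurd (F.commute_of_dvd hodd hgen hi hi' j k l j' k' l').eq huv

/-- The maximal index is `p ^ t` unless `p = 2` and `t = 1`. -/
theorem isIMax (F : IsFrame p s t α β x y w z) (hp : p.Prime)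
    (hgen : Subgroup.closure {x, y} = ⊤) (hz1 : z ≠ 1)
    {φ : G →* Multiplicative (ZMod (p ^ s) × ZMod (p ^ t))}
    (hφx : φ x = Multiplicative.ofAdd (1, 0)) (hφy : φ y = Multiplicative.ofAdd (0, 1))
    (ht : p = 2 → 2 ≤ t) : IsIMax p G t := by
  have hfin := (F.finite_and_card_le hp.ne_zero hgen).1
  have : NeZero (p ^ t) := ⟨pow_ne_zero t hp.ne_zero⟩
  have hle (H : Subgroup G) (hH : ∃ u ∈ H, ∃ v ∈ H, u * v ≠ v * u) : H.index ≤ p ^ t := by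
    rcases F.index_le hp hgen hz1 hφx hφy H hH with h | ⟨rfl, h⟩
    · exact h
    · exact h.trans (Nat.pow_le_pow_right two_pos (ht rfl))
  have hne : ∃ u ∈ Subgroup.closure {x, w}, ∃ v ∈ Subgroup.closure {x, w}, u * v ≠ v * u :=
    ⟨w, Subgroup.subset_closure (Set.mem_insert_of_mem _ rfl), x,
      Subgroup.subset_closure (Set.mem_insert _ _), by
        rw [F.wx, Ne, mul_eq_left]; exact hz1⟩
  refine IsIMax.of_nonabelian hle (Subgroup.closure {x, w}) hne ((hle _ hne).antisymm ?_)
  -- `⟨x, w⟩` lies in the kernel of the projection to the second factor, which has index `p ^ t`.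
  let φ₂ : G →* Multiplicative (ZMod (p ^ t)) :=
    (AddMonoidHom.toMultiplicative (AddMonoidHom.snd _ _)).comp φ
  have hφ₂ (g : G) : φ₂ g = Multiplicative.ofAdd (φ g).toAdd.2 := rfl
  have hsurj : Function.Surjective φ₂ := fun c => by
    refine ⟨y ^ c.toAdd.val, ?_⟩
    rw [map_pow, hφ₂, hφy, ← ofAdd_nsmul]
    simp
  have hidx : φ₂.ker.index = p ^ t := by
    rw [Subgroup.index_ker, MonoidHom.range_eq_top.2 hsurj, Subgroup.card_top]
    simp
  have hsub : Subgroup.closure {x, w} ≤ φ₂.ker := by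
    rw [Subgroup.closure_le]
    rintro u (rfl | rfl)
    · rw [SetLike.mem_coe, MonoidHom.mem_ker, hφ₂, hφx]; rfl
    · exact F.map_w φ₂
  rw [← hidx]
  exact Nat.le_of_dvd (Nat.pos_of_ne_zero Subgroup.index_ne_zero_of_finite)
    (Subgroup.index_dvd_of_le hsub)

/-- For `p = 2` and `t = 1` the maximal index is `4`. -/
theorem isIMax_two (F : IsFrame 2 s 1 α β x y w z) (hs : 1 ≤ s)
    (hgen : Subgroup.closure {x, y} = ⊤) (hz1 : z ≠ 1)
    {φ : G →* Multiplicative (ZMod (2 ^ s) × ZMod (2 ^ 1))}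
    (hφx : φ x = Multiplicative.ofAdd (1, 0)) (hφy : φ y = Multiplicative.ofAdd (0, 1)) :
    IsIMax 2 G 2 := by
  have hz := F.z_central hgen
  have hfin := (F.finite_and_card_le two_ne_zero hgen).1
  have hle (H : Subgroup G) (hH : ∃ u ∈ H, ∃ v ∈ H, u * v ≠ v * u) : H.index ≤ 2 ^ 2 := by
    rcases F.index_le Nat.prime_two hgen hz1 hφx hφy H hH with h | ⟨-, h⟩
    · exact h.trans (by norm_num)
    · exact h
  have hne : ∃ u ∈ Subgroup.closure {x ^ 2, y}, ∃ v ∈ Subgroup.closure {x ^ 2, y}, u * v ≠ v * u :=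
    ⟨x ^ 2, Subgroup.subset_closure (Set.mem_insert _ _), y,
      Subgroup.subset_closure (Set.mem_insert_of_mem _ rfl), by
        rw [F.sq_x_mul_y, Ne, mul_eq_left]; exact hz1⟩
  refine IsIMax.of_nonabelian hle (Subgroup.closure {x ^ 2, y}) hne ((hle _ hne).antisymm ?_)
  have hw : φ w = 1 := F.map_w φ
  have hφz : φ z = 1 := F.map_z φ
  let ψ : G →* Multiplicative (ZMod 2) :=
    (AddMonoidHom.toMultiplicative ((ZMod.castHom (dvd_pow_self 2 (by omega) : 2 ∣ 2 ^ s)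
      (ZMod 2)).toAddMonoidHom.comp (AddMonoidHom.fst _ _))).comp φ
  have hψ (g : G) : ψ g = Multiplicative.ofAdd (ZMod.castHom (dvd_pow_self 2 (by omega) : 2 ∣ 2 ^ s)
      (ZMod 2) (φ g).toAdd.1) := rfl
  have hψx : ψ x = Multiplicative.ofAdd 1 := by
    rw [hψ, hφx]
    exact congrArg _ (map_one _)
  have hsurj : Function.Surjective ψ := fun c => by
    refine ⟨x ^ c.toAdd.val, ?_⟩
    rw [map_pow, hψx, ← ofAdd_nsmul]
    simp
  have hidx : ψ.ker.index = 2 := by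
    rw [Subgroup.index_ker, MonoidHom.range_eq_top.2 hsurj, Subgroup.card_top]
    simp
  have hsub : Subgroup.closure {x ^ 2, y} ≤ ψ.ker := by
    rw [Subgroup.closure_le]
    rintro u (rfl | rfl)
    · rw [SetLike.mem_coe, MonoidHom.mem_ker, map_pow, hψx, ← ofAdd_nsmul]
      rfl
    · rw [SetLike.mem_coe, MonoidHom.mem_ker, hψ, hφy]
      exact congrArg _ (map_zero _)
  have hwψ : w ∈ ψ.ker := F.map_w ψ
  -- Modulo `⟨z⟩` the generators commute, so `w` would be `x ^ (2 * i) * y ^ j * z ^ a`. Its trivial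
  -- image under `φ` forces `2 ^ s ∣ 2 * i` and `2 ∣ j`, so `w` is a power of `z`, against `[w, x] =
  -- z ≠ 1`.
  have hwnot : w ∉ Subgroup.closure {x ^ 2, y} := by
    intro hmem
    let Z : Subgroup G := Subgroup.zpowers z
    have hZ : Z.Normal := ⟨by
      rintro _ ⟨a, rfl⟩ g
      refine ⟨a, ?_⟩
      change z ^ a = g * z ^ a * g⁻¹
      rw [← ((hz g).zpow_left a).eq, mul_inv_cancel_right]⟩
    have hcomm : Commute ((x ^ 2 : G) : G ⧸ Z) (y : G ⧸ Z) := by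
      rw [Commute, SemiconjBy, ← QuotientGroup.mk_mul, ← QuotientGroup.mk_mul, eq_comm,
        QuotientGroup.eq, F.sq_x_mul_y, inv_mul_cancel_left]
      exact Subgroup.mem_zpowers z
    have hmem' : (w : G ⧸ Z) ∈ Subgroup.closure {((x ^ 2 : G) : G ⧸ Z), (y : G ⧸ Z)} := by
      have := Subgroup.mem_map_of_mem (QuotientGroup.mk' Z) hmem
      rwa [MonoidHom.map_closure, Set.image_pair] at this
    obtain ⟨i, j, hij⟩ := exists_zpow_mul_zpow_of_mem_closure_pair hcomm hmem'
    rw [← QuotientGroup.mk_zpow, ← QuotientGroup.mk_zpow, ← QuotientGroup.mk_mul, eq_comm,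
      QuotientGroup.eq] at hij
    obtain ⟨a, ha : z ^ a = _⟩ := hij
    have hwa : w = (x ^ 2) ^ i * y ^ j * z ^ a := by
      rw [ha, mul_inv_cancel_left]
    have hφw := congrArg φ hwa
    rw [hw] at hφw
    simp only [map_mul, map_zpow, map_pow, hφx, hφy, hφz, one_zpow, mul_one, ← ofAdd_nsmul,
      ← ofAdd_zsmul, ← ofAdd_add] at hφw
    rw [eq_comm, ofAdd_eq_one, Prod.ext_iff] at hφw
    have hi : (((2 * i : ℤ)) : ZMod (2 ^ s)) = 0 := by
      have := hφw.1
      simp at this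
      push_cast
      linear_combination this
    have hj : ((j : ℤ) : ZMod (2 ^ 1)) = 0 := by simpa using hφw.2
    rw [ZMod.intCast_zmod_eq_zero_iff_dvd] at hi hj
    obtain ⟨b, hb⟩ := hi
    obtain ⟨c, hc⟩ := hj
    have hwz : w = z ^ (α * b + β * c + a) := by
      have hx2 : (x ^ 2) ^ i = z ^ (α * b) := by
        rw [← zpow_natCast x, ← zpow_mul, Nat.cast_ofNat, hb, zpow_mul, zpow_natCast, F.xs, zpow_mul]
      have hy2 : y ^ j = z ^ (β * c) := by
        rw [hc, zpow_mul, zpow_natCast, F.yt, zpow_mul]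
      rw [hwa, hx2, hy2, zpow_add, zpow_add]
    refine hz1 ?_
    have := F.wx
    rwa [show w * x = x * w by rw [hwz]; exact ((hz x).zpow_left _).eq, left_eq_mul] at this
  -- The subgroup is properly contained in one of index `2`, so its index is at least `4`.
  have hrel := Subgroup.relIndex_mul_index hsub
  rw [hidx] at hrel
  have h0 : (Subgroup.closure {x ^ 2, y}).index ≠ 0 := Subgroup.index_ne_zero_of_finite
  have h1 : (Subgroup.closure {x ^ 2, y}).relIndex ψ.ker ≠ 1 := fun h =>
    hwnot (Subgroup.relIndex_eq_one.1 h hwψ)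
  omega

end IsFrame

/-! ### Recognizing frames from commutator relations. -/

lemma commR_eq_iff {G : Type*} [Group G] {x y w : G} : commR x y = w ↔ x * y = y * x * w := by
  rw [commR, mul_assoc, ← mul_inv_rev, inv_mul_eq_iff_eq_mul]

lemma map_commR {G K : Type*} [Group G] [Group K] (f : G →* K) (x y : G) :
    f (commR x y) = commR (f x) (f y) := by
  simp [commR]

lemma zpow_eq_zpow_of_dvd_sub {G : Type*} [Group G] {z : G} {p : ℕ} (hz : z ^ p = 1) {k l : ℤ}
    (h : (p : ℤ) ∣ k - l) : z ^ k = z ^ l := by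
  obtain ⟨c, hc⟩ := h
  rw [show k = l + p * c by omega, zpow_add, zpow_mul, zpow_natCast, hz, one_zpow, mul_one]

/-- Invertibility modulo `p` is all that matters about `ν`: zero is a square, so a non-residue is
nonzero. -/
lemma IsOneOrNonresidue.exists_inverse {p : ℕ} (hp : p.Prime) {ν : ℤ} (h : IsOneOrNonresidue p ν) :
    ∃ μ : ℤ, (p : ℤ) ∣ μ * ν - 1 := by
  have : Fact p.Prime := ⟨hp⟩
  have hν : (ν : ZMod p) ≠ 0 := by
    rcases h with rfl | h
    · simp
    · exact fun h0 => h (h0 ▸ IsSquare.zero)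
  obtain ⟨μ, hμ⟩ := ZMod.intCast_surjective ((ν : ZMod p)⁻¹)
  refine ⟨μ, (ZMod.intCast_zmod_eq_zero_iff_dvd _ _).1 ?_⟩
  push_cast
  rw [hμ, inv_mul_cancel₀ hν, sub_self]

namespace IsFrame

variable {p s t : ℕ} {α β : ℤ} {G : Type*} [Group G] {x y w z : G}

/-- A frame in which `z` is a power of `x ^ p ^ s`. -/
lemma of_mem_zpowers_x (hp : p.Prime) (hs : 1 ≤ s) (hs2 : p = 2 → 2 ≤ s) (hxy : commR x y = w)
    (hwx : commR w x = z) (hwy : commR w y = 1) (hwp : w ^ p = 1) (hzp : z ^ p = 1) {γ : ℤ}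
    (hz : z = (x ^ p ^ s) ^ γ) (hxs : x ^ p ^ s = z ^ α) (hyt : y ^ p ^ t = z ^ β) :
    IsFrame p s t α β x y w z := by
  rw [commR_eq_iff] at hxy hwx hwy
  rw [mul_one] at hwy
  have hzx : Commute z x := hz ▸ ((Commute.refl x).pow_left _).zpow_left γ
  have hps : p ∣ p ^ s := dvd_pow_self p (by omega)
  have hpow {u : G} (hu : u ^ p = 1) {q : ℕ} (hq : p ∣ q) : u ^ q = 1 := by
    obtain ⟨c, rfl⟩ := hq
    rw [pow_mul, hu, one_pow]
  -- Centrality of `z` is not among the given relations. It follows because the collection formulas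
  -- make `x ^ p ^ s` commute with `w` and then with `y`.
  have hxw : Commute (x ^ p ^ s) w := by
    have := mul_pow_of_commutator hwx hzx (p ^ s)
    rw [hpow hzp hps, mul_one] at this
    exact this.symm
  have hzw : Commute z w := hz ▸ hxw.zpow_left γ
  have hxy' : Commute (x ^ p ^ s) y := by
    have := pow_mul_of_commutators hxy hwx hzx hzw (p ^ s)
    rwa [hpow hzp (dvd_pow_choose_two hp hs hs2), hpow hwp hps, mul_one, mul_one] at this
  exact ⟨hxy, hwx, hwy, hzx, hz ▸ hxy'.zpow_left γ, hwp, hzp, hxs, hyt⟩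

/-- A frame in which `z` is a power of `y ^ p ^ t`. -/
lemma of_mem_zpowers_y (ht : 1 ≤ t) (hxy : commR x y = w)
    (hwx : commR w x = z) (hwy : commR w y = 1) (hwp : w ^ p = 1) (hzp : z ^ p = 1) {γ : ℤ}
    (hz : z = (y ^ p ^ t) ^ γ) (hxs : x ^ p ^ s = z ^ α) (hyt : y ^ p ^ t = z ^ β) :
    IsFrame p s t α β x y w z := by
  rw [commR_eq_iff] at hxy hwx hwy
  rw [mul_one] at hwy
  have hyx : Commute (y ^ p ^ t) x := by
    have := mul_pow_of_commutator hxy hwy (p ^ t)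
    obtain ⟨c, hc⟩ : p ∣ p ^ t := dvd_pow_self p (by omega)
    rw [show w ^ p ^ t = 1 by rw [hc, pow_mul, hwp, one_pow], mul_one] at this
    exact this.symm
  exact ⟨hxy, hwx, hwy, hz ▸ hyx.zpow_left γ, hz ▸ ((Commute.refl y).pow_left _).zpow_left γ,
    hwp, hzp, hxs, hyt⟩

lemma commR_xy (F : IsFrame p s t α β x y w z) : commR x y = w := commR_eq_iff.2 F.xy

lemma commR_yx (F : IsFrame p s t α β x y w z) : commR y x = w⁻¹ := by
  rw [commR_eq_iff, F.xy, mul_inv_cancel_right]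

lemma commR_wx (F : IsFrame p s t α β x y w z) : commR w x = z := commR_eq_iff.2 F.wx

lemma commR_wy (F : IsFrame p s t α β x y w z) : commR w y = 1 :=
  commR_eq_iff.2 (by rw [mul_one, F.wy])

lemma commR_inv_wx (F : IsFrame p s t α β x y w z) : commR w⁻¹ x = z⁻¹ := by
  have h := F.wx
  rw [commR_eq_iff, inv_mul_eq_iff_eq_mul, ← mul_assoc, ← mul_assoc, h, mul_assoc x, ← F.commute_zw.eq,
    ← mul_assoc, mul_inv_cancel_right, mul_inv_cancel_right]

lemma commR_inv_wy (F : IsFrame p s t α β x y w z) : commR w⁻¹ y = 1 := by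
  have h : Commute w y := F.wy
  rw [commR_eq_iff, mul_one, h.inv_left.eq]

lemma commR_zx (F : IsFrame p s t α β x y w z) : commR z x = 1 :=
  commR_eq_iff.2 (by rw [mul_one, F.zx])

lemma commR_zy (F : IsFrame p s t α β x y w z) : commR z y = 1 :=
  commR_eq_iff.2 (by rw [mul_one, F.zy])

lemma zpow_pow_p (F : IsFrame p s t α β x y w z) (k : ℤ) : (z ^ k) ^ p = 1 := by
  rw [← zpow_natCast, ← zpow_mul, mul_comm, zpow_mul, zpow_natCast, F.zp, one_zpow]

lemma pow_x_succ (F : IsFrame p s t α β x y w z) : x ^ p ^ (s + 1) = 1 := by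
  rw [pow_succ, pow_mul, F.xs, F.zpow_pow_p]

lemma pow_y_succ (F : IsFrame p s t α β x y w z) : y ^ p ^ (t + 1) = 1 := by
  rw [pow_succ, pow_mul, F.yt, F.zpow_pow_p]

end IsFrame

/-- `G` is generated by the first two elements of a frame with `z ≠ 1`, and maps onto
`ℤ/p^s × ℤ/p^t`. -/
def HasFrame (p s t : ℕ) (G : Type*) [Group G] : Prop :=
  ∃ (α β : ℤ) (x y w z : G), IsFrame p s t α β x y w z ∧ Subgroup.closure {x, y} = ⊤ ∧ z ≠ 1 ∧
    ∃ φ : G →* Multiplicative (ZMod (p ^ s) × ZMod (p ^ t)),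
      φ x = Multiplicative.ofAdd (1, 0) ∧ φ y = Multiplicative.ofAdd (0, 1)

theorem HasFrame.isIMax {p s t : ℕ} {G : Type*} [Group G] (h : HasFrame p s t G) (hp : p.Prime)
    (ht : p = 2 → 2 ≤ t) : IsIMax p G t := by
  obtain ⟨α, β, x, y, w, z, F, hgen, hz, φ, hφx, hφy⟩ := h
  exact F.isIMax hp hgen hz hφx hφy ht

theorem HasFrame.isIMax_two {s : ℕ} {G : Type*} [Group G] (h : HasFrame 2 s 1 G) (hs : 1 ≤ s) :
    IsIMax 2 G 2 := by
  obtain ⟨α, β, x, y, w, z, F, hgen, hz, φ, hφx, hφy⟩ := h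
  exact F.isIMax_two hs hgen hz hφx hφy

/-- A group generated by a frame that maps to every other frame with the same parameters. -/
theorem IsFrame.hasFrame {p s t : ℕ} {α β : ℤ} {G : Type*} [Group G] {x y w z : G}
    (F : IsFrame p s t α β x y w z) (hp : p.Prime) (hs : 1 ≤ s) (ht : 1 ≤ t) (hs2 : p = 2 → 2 ≤ s)
    (hgen : Subgroup.closure {x, y} = ⊤)
    (h : ∀ (M : Type) [Group M] (x' y' w' z' : M), IsFrame p s t α β x' y' w' z' →
      ∃ f : G →* M, f x = x' ∧ f y = y') : HasFrame p s t G := by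
  -- The homomorphism to the model carries `z` to a nontrivial element, and composing with it gives
  -- the map to `ℤ/p^s × ℤ/p^t`.
  obtain ⟨M, _, x', y', w', z', F', hz', φ, hφx, hφy⟩ := exists_frame hp hs ht hs2 α β
  obtain ⟨f, rfl, rfl⟩ := h M x' y' w' z' F'
  have hw : f w = w' := by rw [← F.commR_xy, ← F'.commR_xy, map_commR]
  have hz : f z = z' := by rw [← F.commR_wx, ← F'.commR_wx, map_commR, hw]
  exact ⟨α, β, x, y, w, z, F, hgen, fun h1 => hz' (by rw [← hz, h1, map_one]), φ.comp f, hφx, hφy⟩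

/-! ### Frames in the presented groups. -/

section Presentations

variable {p n m : ℕ}

lemma closure_pair_eq_top_of_presented {k : ℕ} {rels : Set (FreeGroup (Fin k))}
    {x y : PresentedGroup rels} (h : ∀ i, PresentedGroup.of i ∈ Subgroup.closure {x, y}) :
    Subgroup.closure {x, y} = ⊤ := by
  rw [eq_top_iff, ← PresentedGroup.closure_range_of, Subgroup.closure_le]
  rintro _ ⟨i, rfl⟩
  exact h i

lemma commR_mem {G : Type*} [Group G] {H : Subgroup G} {x y : G} (hx : x ∈ H) (hy : y ∈ H) :
    commR x y ∈ H :=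
  mul_mem (mul_mem (mul_mem (inv_mem hx) (inv_mem hy)) hx) hy

lemma presented_relations {k : ℕ} (rels : Set (FreeGroup (Fin k))) :
    ∀ r ∈ rels, FreeGroup.lift (fun i => (PresentedGroup.of i : PresentedGroup rels)) r = 1 := by
  intro r hr
  have h := PresentedGroup.one_of_mem hr
  have : FreeGroup.lift (fun i => (PresentedGroup.of i : PresentedGroup rels)) =
      PresentedGroup.mk rels := by
    ext i
    simp [PresentedGroup.of]
  rw [this, h]

lemma lift_relsJ1 {M : Type*} [Group M] (g : Fin 3 → M) (ν : ℤ) :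
    (∀ r ∈ relsJ1 p n m ν, FreeGroup.lift g r = 1) ↔
      g 0 ^ p ^ (n + 1) = 1 ∧ g 1 ^ p ^ m = 1 ∧ g 2 ^ p = 1 ∧ commR (g 0) (g 1) = g 2 ∧
        commR (g 2) (g 0) = 1 ∧ commR (g 2) (g 1) = g 0 ^ (ν * (p : ℤ) ^ n) := by
  simp [relsJ1, map_commR, mul_inv_eq_one]

lemma lift_relsJ2 {M : Type*} [Group M] (g : Fin 3 → M) :
    (∀ r ∈ relsJ2 p n m, FreeGroup.lift g r = 1) ↔
      g 0 ^ p ^ (n + 1) = 1 ∧ g 1 ^ p ^ m = 1 ∧ g 2 ^ p = 1 ∧ commR (g 0) (g 1) = g 2 ∧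
        commR (g 2) (g 0) = g 0 ^ p ^ n ∧ commR (g 2) (g 1) = 1 := by
  simp [relsJ2, map_commR, mul_inv_eq_one]

lemma lift_relsJ3 {M : Type*} [Group M] (g : Fin 3 → M) :
    (∀ r ∈ relsJ3 p n m, FreeGroup.lift g r = 1) ↔
      g 0 ^ p ^ n = 1 ∧ g 1 ^ p ^ (m + 1) = 1 ∧ g 2 ^ p = 1 ∧ commR (g 0) (g 1) = g 2 ∧
        commR (g 2) (g 0) = 1 ∧ commR (g 2) (g 1) = g 1 ^ p ^ m := by
  simp [relsJ3, map_commR, mul_inv_eq_one]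

lemma lift_relsJ4 {M : Type*} [Group M] (g : Fin 3 → M) (ν : ℤ) :
    (∀ r ∈ relsJ4 p n m ν, FreeGroup.lift g r = 1) ↔
      g 0 ^ p ^ n = 1 ∧ g 1 ^ p ^ (m + 1) = 1 ∧ g 2 ^ p = 1 ∧ commR (g 0) (g 1) = g 2 ∧
        commR (g 2) (g 0) = g 1 ^ (ν * (p : ℤ) ^ m) ∧ commR (g 2) (g 1) = 1 := by
  simp [relsJ4, map_commR, mul_inv_eq_one]

lemma lift_relsJ5 {M : Type*} [Group M] (g : Fin 4 → M) :
    (∀ r ∈ relsJ5 p n m, FreeGroup.lift g r = 1) ↔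
      g 0 ^ p ^ n = 1 ∧ g 1 ^ p ^ m = 1 ∧ g 2 ^ p = 1 ∧ g 3 ^ p = 1 ∧ commR (g 0) (g 1) = g 2 ∧
        commR (g 2) (g 0) = 1 ∧ commR (g 2) (g 1) = g 3 ∧ commR (g 3) (g 0) = 1 ∧
          commR (g 3) (g 1) = 1 := by
  simp [relsJ5, map_commR, mul_inv_eq_one]

lemma lift_relsJ6 {M : Type*} [Group M] (g : Fin 4 → M) :
    (∀ r ∈ relsJ6 p n m, FreeGroup.lift g r = 1) ↔
      g 0 ^ p ^ n = 1 ∧ g 1 ^ p ^ m = 1 ∧ g 2 ^ p = 1 ∧ g 3 ^ p = 1 ∧ commR (g 0) (g 1) = g 2 ∧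
        commR (g 2) (g 0) = g 3 ∧ commR (g 2) (g 1) = 1 ∧ commR (g 3) (g 0) = 1 ∧
          commR (g 3) (g 1) = 1 := by
  simp [relsJ6, map_commR, mul_inv_eq_one]

lemma lift_relsH3 {M : Type*} [Group M] (g : Fin 3 → M) :
    (∀ r ∈ relsH3, FreeGroup.lift g r = 1) ↔
      g 0 ^ 8 = 1 ∧ g 2 ^ 2 = 1 ∧ g 1 ^ 2 = g 0 ^ 4 ∧ commR (g 0) (g 1) = g 2 ∧
        commR (g 2) (g 0) = g 1 ^ 2 ∧ commR (g 2) (g 1) = 1 := by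
  simp [relsH3, map_commR, mul_inv_eq_one]

/-- The relations with the roles of the two generators exchanged. -/
lemma commR_swap {G : Type*} [Group G] {a b c e : G} (hab : commR a b = c) (hca : commR c a = 1)
    (hcb : commR c b = e) (hec : Commute e c) :
    commR b a = c⁻¹ ∧ commR c⁻¹ b = e⁻¹ ∧ commR c⁻¹ a = 1 := by
  rw [commR_eq_iff] at hab hca hcb
  refine ⟨?_, ?_, ?_⟩ <;> rw [commR_eq_iff]
  · rw [hab, mul_inv_cancel_right]
  · rw [inv_mul_eq_iff_eq_mul, ← mul_assoc, ← mul_assoc, hcb, mul_assoc b, ← hec.eq, ← mul_assoc,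
      mul_inv_cancel_right, mul_inv_cancel_right]
  · rw [mul_one] at hca ⊢
    have h : Commute c a := hca
    exact h.inv_left.eq

/-- The generator acting nontrivially on `c` is `b`, so the roles are exchanged: `x = b`, `y = a`,
`w = c⁻¹`, and the parameters become `s = m`, `t = n`. As `z` is the `(-ν)`-th power of `a ^ p ^ n`,
the exponent `β` is `-μ` with `μ` inverse to `ν` modulo `p`. -/
theorem hasFrame_J1 (hp : p.Prime) (hn : 1 ≤ n) (hm : 1 ≤ m) (hm2 : p = 2 → 2 ≤ m) {ν : ℤ}
    (hν : IsOneOrNonresidue p ν) : HasFrame p m n (PresentedGroup (relsJ1 p n m ν)) := by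
  obtain ⟨μ, hμ⟩ := hν.exists_inverse hp
  obtain ⟨ha, hb, hc, hab, hca, hcb⟩ := (lift_relsJ1 _ ν).1 (presented_relations (relsJ1 p n m ν))
  set a : PresentedGroup (relsJ1 p n m ν) := PresentedGroup.of 0 with ha_def
  set b : PresentedGroup (relsJ1 p n m ν) := PresentedGroup.of 1 with hb_def
  set c : PresentedGroup (relsJ1 p n m ν) := PresentedGroup.of 2 with hc_def
  have haq : (a ^ p ^ n) ^ p = 1 := by rw [← pow_mul, ← pow_succ, ha]
  have hec : Commute (a ^ (ν * (p : ℤ) ^ n)) c := by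
    have : Commute c a := by rw [commR_eq_iff, mul_one] at hca; exact hca
    exact (this.zpow_right _).symm
  obtain ⟨h1, h2, h3⟩ := commR_swap hab hca hcb hec
  have hz : (a ^ (ν * (p : ℤ) ^ n))⁻¹ = (a ^ p ^ n) ^ (-ν) := by
    rw [← zpow_natCast, ← zpow_mul, ← zpow_neg, Nat.cast_pow, mul_neg, mul_comm ν]
  have F : IsFrame p m n 0 (-μ) b a c⁻¹ (a ^ (ν * (p : ℤ) ^ n))⁻¹ := by
    refine IsFrame.of_mem_zpowers_y hn h1 h2 h3 (by rw [inv_pow, hc, inv_one]) ?_ hz ?_ ?_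
    · rw [hz, ← zpow_natCast, ← zpow_mul, mul_comm, zpow_mul, zpow_natCast, haq, one_zpow]
    · rw [hb, zpow_zero]
    · rw [hz, ← zpow_mul]
      conv_lhs => rw [← zpow_one (a ^ p ^ n)]
      refine zpow_eq_zpow_of_dvd_sub haq ?_
      rw [← dvd_neg, show -(1 - -ν * -μ) = μ * ν - 1 by ring]
      exact hμ
  refine F.hasFrame hp hm hn hm2 (closure_pair_eq_top_of_presented fun i => ?_)
    fun M _ x y w z F' => ?_
  · have hA : a ∈ Subgroup.closure {b, a} := Subgroup.subset_closure (by simp)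
    have hB : b ∈ Subgroup.closure {b, a} := Subgroup.subset_closure (by simp)
    have hC : c ∈ Subgroup.closure {b, a} := hab ▸ commR_mem hA hB
    fin_cases i
    exacts [hA, hB, hC]
  · have hrel : ∀ r ∈ relsJ1 p n m ν, FreeGroup.lift ![y, x, w⁻¹] r = 1 := by
      rw [lift_relsJ1]
      refine ⟨F'.pow_y_succ, ?_, ?_, F'.commR_yx, F'.commR_inv_wy, ?_⟩
      · simpa using F'.xs
      · change w⁻¹ ^ p = 1
        rw [inv_pow, F'.wp, inv_one]
      · change commR w⁻¹ x = y ^ (ν * (p : ℤ) ^ n)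
        rw [F'.commR_inv_wx, mul_comm ν, zpow_mul, ← Nat.cast_pow, zpow_natCast, F'.yt, ← zpow_mul,
          ← zpow_neg_one]
        refine zpow_eq_zpow_of_dvd_sub F'.zp ?_
        convert hμ using 1
        ring
    exact ⟨PresentedGroup.toGroup hrel, by simp [hb_def], by simp [ha_def]⟩

theorem hasFrame_J2 (hp : p.Prime) (hn : 1 ≤ n) (hm : 1 ≤ m) (hn2 : p = 2 → 2 ≤ n) :
    HasFrame p n m (PresentedGroup (relsJ2 p n m)) := by
  obtain ⟨ha, hb, hc, hab, hca, hcb⟩ := (lift_relsJ2 _).1 (presented_relations (relsJ2 p n m))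
  set a : PresentedGroup (relsJ2 p n m) := PresentedGroup.of 0 with ha_def
  set b : PresentedGroup (relsJ2 p n m) := PresentedGroup.of 1 with hb_def
  set c : PresentedGroup (relsJ2 p n m) := PresentedGroup.of 2
  have F : IsFrame p n m 1 0 a b c (a ^ p ^ n) :=
    IsFrame.of_mem_zpowers_x hp hn hn2 hab hca hcb hc (by rw [← pow_mul, ← pow_succ, ha])
      (zpow_one _).symm (zpow_one _).symm (by rw [hb, zpow_zero])
  refine F.hasFrame hp hn hm hn2 (closure_pair_eq_top_of_presented fun i => ?_)
    fun M _ x y w z F' => ?_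
  · have hA : a ∈ Subgroup.closure {a, b} := Subgroup.subset_closure (by simp)
    have hB : b ∈ Subgroup.closure {a, b} := Subgroup.subset_closure (by simp)
    have hC : c ∈ Subgroup.closure {a, b} := hab ▸ commR_mem hA hB
    fin_cases i
    exacts [hA, hB, hC]
  · have hrel : ∀ r ∈ relsJ2 p n m, FreeGroup.lift ![x, y, w] r = 1 := by
      rw [lift_relsJ2]
      refine ⟨F'.pow_x_succ, ?_, F'.wp, F'.commR_xy, ?_, F'.commR_wy⟩
      · simpa using F'.yt
      · exact F'.commR_wx.trans (by simpa using F'.xs.symm)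
    exact ⟨PresentedGroup.toGroup hrel, by simp [ha_def], by simp [hb_def]⟩

theorem hasFrame_J3 (hp : p.Prime) (hn : 1 ≤ n) (hm : 1 ≤ m) (hm2 : p = 2 → 2 ≤ m) :
    HasFrame p m n (PresentedGroup (relsJ3 p n m)) := by
  obtain ⟨ha, hb, hc, hab, hca, hcb⟩ := (lift_relsJ3 _).1 (presented_relations (relsJ3 p n m))
  set a : PresentedGroup (relsJ3 p n m) := PresentedGroup.of 0 with ha_def
  set b : PresentedGroup (relsJ3 p n m) := PresentedGroup.of 1 with hb_def
  set c : PresentedGroup (relsJ3 p n m) := PresentedGroup.of 2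
  have hbq : (b ^ p ^ m) ^ p = 1 := by rw [← pow_mul, ← pow_succ, hb]
  -- Moving `c` past `b ^ p ^ m` costs `(b ^ p ^ m) ^ p ^ m`, which is trivial because `p ∣ p ^ m`.
  have hec : Commute (b ^ p ^ m) c := by
    have h := mul_pow_of_commutator (commR_eq_iff.1 hcb) ((Commute.refl b).pow_left _) (p ^ m)
    obtain ⟨k, hk⟩ : p ∣ p ^ m := dvd_pow_self p (by omega)
    rw [show (b ^ p ^ m) ^ p ^ m = 1 by
      conv_lhs => rw [hk, pow_mul, ← hk, hbq, one_pow], mul_one] at h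
    exact h.symm
  obtain ⟨h1, h2, h3⟩ := commR_swap hab hca hcb hec
  have F : IsFrame p m n (-1) 0 b a c⁻¹ (b ^ p ^ m)⁻¹ :=
    IsFrame.of_mem_zpowers_x hp hm hm2 h1 h2 h3 (by rw [inv_pow, hc, inv_one])
      (by rw [inv_pow, hbq, inv_one]) (zpow_neg_one _).symm (by simp) (by rw [ha, zpow_zero])
  refine F.hasFrame hp hm hn hm2 (closure_pair_eq_top_of_presented fun i => ?_)
    fun M _ x y w z F' => ?_
  · have hA : a ∈ Subgroup.closure {b, a} := Subgroup.subset_closure (by simp)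
    have hB : b ∈ Subgroup.closure {b, a} := Subgroup.subset_closure (by simp)
    have hC : c ∈ Subgroup.closure {b, a} := hab ▸ commR_mem hA hB
    fin_cases i
    exacts [hA, hB, hC]
  · have hrel : ∀ r ∈ relsJ3 p n m, FreeGroup.lift ![y, x, w⁻¹] r = 1 := by
      rw [lift_relsJ3]
      refine ⟨?_, F'.pow_x_succ, ?_, F'.commR_yx, F'.commR_inv_wy, ?_⟩
      · simpa using F'.yt
      · change w⁻¹ ^ p = 1
        rw [inv_pow, F'.wp, inv_one]
      · exact F'.commR_inv_wx.trans (by simpa using F'.xs.symm)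
    exact ⟨PresentedGroup.toGroup hrel, by simp [hb_def], by simp [ha_def]⟩

theorem hasFrame_J4 (hp : p.Prime) (hn : 1 ≤ n) (hm : 1 ≤ m) (hn2 : p = 2 → 2 ≤ n) {ν : ℤ}
    (hν : IsOneOrNonresidue p ν) : HasFrame p n m (PresentedGroup (relsJ4 p n m ν)) := by
  obtain ⟨μ, hμ⟩ := hν.exists_inverse hp
  obtain ⟨ha, hb, hc, hab, hca, hcb⟩ := (lift_relsJ4 _ ν).1 (presented_relations (relsJ4 p n m ν))
  set a : PresentedGroup (relsJ4 p n m ν) := PresentedGroup.of 0 with ha_def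
  set b : PresentedGroup (relsJ4 p n m ν) := PresentedGroup.of 1 with hb_def
  set c : PresentedGroup (relsJ4 p n m ν) := PresentedGroup.of 2
  have hbq : (b ^ p ^ m) ^ p = 1 := by rw [← pow_mul, ← pow_succ, hb]
  have hz : b ^ (ν * (p : ℤ) ^ m) = (b ^ p ^ m) ^ ν := by
    rw [← zpow_natCast, ← zpow_mul, Nat.cast_pow, mul_comm ν]
  have F : IsFrame p n m 0 μ a b c (b ^ (ν * (p : ℤ) ^ m)) := by
    refine IsFrame.of_mem_zpowers_y hm hab hca hcb hc ?_ hz ?_ ?_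
    · rw [hz, ← zpow_natCast, ← zpow_mul, mul_comm, zpow_mul, zpow_natCast, hbq, one_zpow]
    · rw [ha, zpow_zero]
    · rw [hz, ← zpow_mul]
      conv_lhs => rw [← zpow_one (b ^ p ^ m)]
      refine zpow_eq_zpow_of_dvd_sub hbq ?_
      rw [← dvd_neg, show -(1 - ν * μ) = μ * ν - 1 by ring]
      exact hμ
  refine F.hasFrame hp hn hm hn2 (closure_pair_eq_top_of_presented fun i => ?_)
    fun M _ x y w z F' => ?_
  · have hA : a ∈ Subgroup.closure {a, b} := Subgroup.subset_closure (by simp)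
    have hB : b ∈ Subgroup.closure {a, b} := Subgroup.subset_closure (by simp)
    have hC : c ∈ Subgroup.closure {a, b} := hab ▸ commR_mem hA hB
    fin_cases i
    exacts [hA, hB, hC]
  · have hrel : ∀ r ∈ relsJ4 p n m ν, FreeGroup.lift ![x, y, w] r = 1 := by
      rw [lift_relsJ4]
      refine ⟨?_, F'.pow_y_succ, F'.wp, F'.commR_xy, ?_, F'.commR_wy⟩
      · simpa using F'.xs
      · change commR w x = y ^ (ν * (p : ℤ) ^ m)
        rw [F'.commR_wx, mul_comm ν, zpow_mul, ← Nat.cast_pow, zpow_natCast, F'.yt, ← zpow_mul]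
        conv_lhs => rw [← zpow_one z]
        refine zpow_eq_zpow_of_dvd_sub F'.zp ?_
        rw [← dvd_neg, show -(1 - μ * ν) = μ * ν - 1 by ring]
        exact hμ
    exact ⟨PresentedGroup.toGroup hrel, by simp [ha_def], by simp [hb_def]⟩

theorem hasFrame_J5 (hp : p.Prime) (hn : 1 ≤ n) (hm : 1 ≤ m) (hm2 : p = 2 → 2 ≤ m) :
    HasFrame p m n (PresentedGroup (relsJ5 p n m)) := by
  obtain ⟨ha, hb, hc, hd, hab, hca, hcb, hda, hdb⟩ :=
    (lift_relsJ5 _).1 (presented_relations (relsJ5 p n m))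
  set a : PresentedGroup (relsJ5 p n m) := PresentedGroup.of 0 with ha_def
  set b : PresentedGroup (relsJ5 p n m) := PresentedGroup.of 1 with hb_def
  set c : PresentedGroup (relsJ5 p n m) := PresentedGroup.of 2
  set d : PresentedGroup (relsJ5 p n m) := PresentedGroup.of 3
  rw [commR_eq_iff, mul_one] at hda hdb
  have hec : Commute d c := by
    have hda' : Commute d a := hda
    have hdb' : Commute d b := hdb
    rw [← hab]
    exact ((hda'.inv_right.mul_right hdb'.inv_right).mul_right hda').mul_right hdb'
  obtain ⟨h1, h2, h3⟩ := commR_swap hab hca hcb hec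
  rw [commR_eq_iff] at h1 h2 h3
  have F : IsFrame p m n 0 0 b a c⁻¹ d⁻¹ :=
    ⟨h1, h2, by rw [h3, mul_one], (Commute.inv_left hdb : Commute d⁻¹ b),
      (Commute.inv_left hda : Commute d⁻¹ a), by rw [inv_pow, hc, inv_one],
      by rw [inv_pow, hd, inv_one], by rw [hb, zpow_zero], by rw [ha, zpow_zero]⟩
  refine F.hasFrame hp hm hn hm2 (closure_pair_eq_top_of_presented fun i => ?_)
    fun M _ x y w z F' => ?_
  · have hA : a ∈ Subgroup.closure {b, a} := Subgroup.subset_closure (by simp)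
    have hB : b ∈ Subgroup.closure {b, a} := Subgroup.subset_closure (by simp)
    have hC : c ∈ Subgroup.closure {b, a} := hab ▸ commR_mem hA hB
    fin_cases i
    exacts [hA, hB, hC, (hcb ▸ commR_mem hC hB : d ∈ _)]
  · have hrel : ∀ r ∈ relsJ5 p n m, FreeGroup.lift ![y, x, w⁻¹, z⁻¹] r = 1 := by
      rw [lift_relsJ5]
      have hzx : Commute z x := F'.zx
      have hzy : Commute z y := F'.zy
      refine ⟨by simpa using F'.yt, by simpa using F'.xs, ?_, ?_, F'.commR_yx, F'.commR_inv_wy,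
        F'.commR_inv_wx, ?_, ?_⟩
      · change w⁻¹ ^ p = 1
        rw [inv_pow, F'.wp, inv_one]
      · change z⁻¹ ^ p = 1
        rw [inv_pow, F'.zp, inv_one]
      · exact commR_eq_iff.2 (hzy.inv_left.eq.trans (mul_one _).symm)
      · exact commR_eq_iff.2 (hzx.inv_left.eq.trans (mul_one _).symm)
    exact ⟨PresentedGroup.toGroup hrel, by simp [hb_def], by simp [ha_def]⟩

theorem hasFrame_J6 (hp : p.Prime) (hn : 1 ≤ n) (hm : 1 ≤ m) (hn2 : p = 2 → 2 ≤ n) :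
    HasFrame p n m (PresentedGroup (relsJ6 p n m)) := by
  obtain ⟨ha, hb, hc, hd, hab, hca, hcb, hda, hdb⟩ :=
    (lift_relsJ6 _).1 (presented_relations (relsJ6 p n m))
  set a : PresentedGroup (relsJ6 p n m) := PresentedGroup.of 0 with ha_def
  set b : PresentedGroup (relsJ6 p n m) := PresentedGroup.of 1 with hb_def
  set c : PresentedGroup (relsJ6 p n m) := PresentedGroup.of 2
  set d : PresentedGroup (relsJ6 p n m) := PresentedGroup.of 3
  rw [commR_eq_iff, mul_one] at hda hdb
  have F : IsFrame p n m 0 0 a b c d :=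
    ⟨commR_eq_iff.1 hab, commR_eq_iff.1 hca, by rw [commR_eq_iff.1 hcb, mul_one], hda, hdb, hc, hd,
      by rw [ha, zpow_zero], by rw [hb, zpow_zero]⟩
  refine F.hasFrame hp hn hm hn2 (closure_pair_eq_top_of_presented fun i => ?_)
    fun M _ x y w z F' => ?_
  · have hA : a ∈ Subgroup.closure {a, b} := Subgroup.subset_closure (by simp)
    have hB : b ∈ Subgroup.closure {a, b} := Subgroup.subset_closure (by simp)
    have hC : c ∈ Subgroup.closure {a, b} := hab ▸ commR_mem hA hB
    fin_cases i
    exacts [hA, hB, hC, (hca ▸ commR_mem hC hA : d ∈ _)]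
  · have hrel : ∀ r ∈ relsJ6 p n m, FreeGroup.lift ![x, y, w, z] r = 1 := by
      rw [lift_relsJ6]
      exact ⟨by simpa using F'.xs, by simpa using F'.yt, F'.wp, F'.zp, F'.commR_xy, F'.commR_wx,
        F'.commR_wy, F'.commR_zx, F'.commR_zy⟩
    exact ⟨PresentedGroup.toGroup hrel, by simp [ha_def], by simp [hb_def]⟩

theorem hasFrame_H3 : HasFrame 2 2 1 (PresentedGroup relsH3) := by
  obtain ⟨ha, hc, hba, hab, hca, hcb⟩ := lift_relsH3 _ |>.1 (presented_relations relsH3)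
  set a : PresentedGroup (relsH3) := PresentedGroup.of 0 with ha_def
  set b : PresentedGroup (relsH3) := PresentedGroup.of 1 with hb_def
  set c : PresentedGroup (relsH3) := PresentedGroup.of 2
  -- Here `a ^ 4 = b ^ 2 = z`, so both exponents `α` and `β` are `1`.
  have F : IsFrame 2 2 1 1 1 a b c (b ^ 2) :=
    IsFrame.of_mem_zpowers_y le_rfl hab hca hcb hc (by rw [hba, ← pow_mul, ha])
      (zpow_one _).symm (by rw [zpow_one, hba]; norm_num) (by simp)
  refine F.hasFrame Nat.prime_two one_le_two le_rfl (fun _ => le_rfl)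
    (closure_pair_eq_top_of_presented fun i => ?_) fun M _ x y w z F' => ?_
  · have hA : a ∈ Subgroup.closure {a, b} := Subgroup.subset_closure (by simp)
    have hB : b ∈ Subgroup.closure {a, b} := Subgroup.subset_closure (by simp)
    have hC : c ∈ Subgroup.closure {a, b} := hab ▸ commR_mem hA hB
    fin_cases i
    exacts [hA, hB, hC]
  · have hrel : ∀ r ∈ relsH3, FreeGroup.lift ![x, y, w] r = 1 := by
      rw [lift_relsH3]
      have hx : x ^ 4 = z := by simpa using F'.xs
      have hy : y ^ 2 = z := by simpa using F'.yt
      exact ⟨F'.pow_x_succ, F'.wp, hy.trans hx.symm, F'.commR_xy, F'.commR_wx.trans hy.symm,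
        F'.commR_wy⟩
    exact ⟨PresentedGroup.toGroup hrel, by simp [ha_def], by simp [hb_def]⟩

end Presentations

theorem theorem4p7 (p n m : ℕ) (hp : p.Prime) (G : Type*) [Group G] :
    (IsTypeF p G → IsIMax p G 1) ∧
    (IsTypeH1 p n m G ∨ IsTypeH2 p n m G ∨ IsTypeH3 p n m G ∨
      IsTypeI1 p n m G ∨ IsTypeI2 p n m G ∨ IsTypeI3 p n m G → IsIMax p G 2) ∧
    (IsTypeG1 p n m G ∨ IsTypeG2 p n m G ∨ IsTypeG3 p n m G ∨
      IsTypeJ2 p n m G ∨ IsTypeJ4 p n m G ∨ IsTypeJ6 p n m G → IsIMax p G m) ∧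
    (IsTypeJ1 p n m G ∨ IsTypeJ3 p n m G ∨ IsTypeJ5 p n m G → IsIMax p G n) := by
  refine ⟨?_, ?_, ?_, ?_⟩
  · rintro ⟨rfl, hcard, _, hclass⟩
    exact isIMax_of_card_eq_81 hcard hclass
  · rintro (⟨rfl, rfl, rfl, ⟨e⟩⟩ | ⟨rfl, rfl, rfl, ⟨e⟩⟩ | ⟨rfl, rfl, rfl, ⟨e⟩⟩ | ⟨rfl, hn, rfl, ⟨e⟩⟩ |
      ⟨rfl, hn, rfl, ⟨e⟩⟩ | ⟨rfl, hn, rfl, ⟨e⟩⟩)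
    · exact ((hasFrame_J6 hp one_le_two le_rfl fun _ => le_rfl).isIMax_two one_le_two).of_mulEquiv e
    · exact ((hasFrame_J2 hp one_le_two le_rfl fun _ => le_rfl).isIMax_two one_le_two).of_mulEquiv e
    · exact (hasFrame_H3.isIMax_two one_le_two).of_mulEquiv e
    · exact ((hasFrame_J6 hp (by omega) le_rfl fun _ => by omega).isIMax_two
        (by omega)).of_mulEquiv e
    · exact ((hasFrame_J2 hp (by omega) le_rfl fun _ => by omega).isIMax_two
        (by omega)).of_mulEquiv e
    · exact ((hasFrame_J4 hp (by omega) le_rfl (fun _ => by omega) (Or.inl rfl)).isIMax_two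
        (by omega)).of_mulEquiv e
  · rintro (⟨rfl, hm, hm2, ν, hν, ⟨e⟩⟩ | ⟨rfl, hm, hm2, ⟨e⟩⟩ | ⟨rfl, hm, hm2, ⟨e⟩⟩ |
      ⟨⟨hm, hmn, hm2⟩, ⟨e⟩⟩ | ⟨⟨hm, hmn, hm2⟩, ν, hν, ⟨e⟩⟩ | ⟨⟨hm, hmn, hm2⟩, ⟨e⟩⟩)
    · have h2 : p = 2 → 2 ≤ n := fun h => hm2 (by omega)
      exact ((hasFrame_J1 hp hm hm h2 hν).isIMax hp h2).of_mulEquiv e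
    · have h2 : p = 2 → 2 ≤ n := fun h => hm2 (by omega)
      exact ((hasFrame_J6 hp hm hm h2).isIMax hp h2).of_mulEquiv e
    · have h2 : p = 2 → 2 ≤ n := fun h => hm2 (by omega)
      exact ((hasFrame_J2 hp hm hm h2).isIMax hp h2).of_mulEquiv e
    · exact ((hasFrame_J2 hp (by omega) hm fun h => le_trans (hm2 h) hmn.le).isIMax hp
        hm2).of_mulEquiv e
    · exact ((hasFrame_J4 hp (by omega) hm (fun h => le_trans (hm2 h) hmn.le) hν).isIMax hp
        hm2).of_mulEquiv e
    · exact ((hasFrame_J6 hp (by omega) hm fun h => le_trans (hm2 h) hmn.le).isIMax hp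
        hm2).of_mulEquiv e
  · rintro (⟨⟨hm, hmn, hm2⟩, ν, hν, ⟨e⟩⟩ | ⟨⟨hm, hmn, hm2⟩, ⟨e⟩⟩ | ⟨⟨hm, hmn, hm2⟩, ⟨e⟩⟩)
    · exact ((hasFrame_J1 hp (by omega) hm hm2 hν).isIMax hp fun h =>
        le_trans (hm2 h) hmn.le).of_mulEquiv e
    · exact ((hasFrame_J3 hp (by omega) hm hm2).isIMax hp fun h =>
        le_trans (hm2 h) hmn.le).of_mulEquiv e
    · exact ((hasFrame_J5 hp (by omega) hm hm2).isIMax hp fun h =>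
        le_trans (hm2 h) hmn.le).of_mulEquiv e
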